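/- Let $d\in\{2,3\}$ and let $\sigma,\tau,C$ be real constants. All simplices $K$ below are closed, $h_K=\operatorname{diam}K$. **Setting.** Let $\Omega\subset\mathbb R^d$ be a bounded Lipschitz domain, divided by a smooth embedded interface $\Gamma\subset\Omega$ into two nonempty open sets $\Omega_1,\Omega_2$, i.e. $\Omega$ is the disjoint union of $\Omega_1$, $\Gamma$ and $\Omega_2$, and every point of $\overline\Gamma$ has a neighborhood $U$ with a smooth function $\psi:U\to\mathbb R$, $\nabla\psi\neq0$, such that in $U\cap\Omega$ the sets $\Omega_1,\Gamma,\Omega_2$ are $\{\psi>0\},\{\psi=0\},\{\psi<0\}$ ($\Gamma$ may reach $\partial\Omega$). Let $\mathcal T_h$ be a finite conforming triangulation of $\Omega$ into $d$-simplices with $\bigcup_{K\in\mathcal T_h}K=\overline\Omega$ that is shape regular (each $K$ contains a ball of radius $\rho_K>0$ with $h_K\le\sigma\rho_K$) and quasiuniform ($h_K\le h\le\tau h_K$ for all $K$), and let $0\le\delta\le Ch$. For $k=1,2$ let $$\mathcal T_{h,k}=\{K\in\mathcal T_h:\ \exists\,x\in K,\ \operatorname{dist}(x,\Omega_k)\le\delta\},\qquad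 \Omega_{h,k}=\operatorname{int}\bigcup_{K\in\mathcal T_{h,k}}K,$$ let $V_{h,k}$ be the space of continuous functions that are affine on each $K\in\mathcal T_{h,k}$ and vanish on $\partial\Omega\cap\partial\Omega_{h,k}$, with Lagrange nodal basis $\varphi_1,\dots,\varphi_N$ (one function for each vertex of $\mathcal T_{h,k}$ not on $\partial\Omega$), and put $$\mathcal P_k\mathbf v=\sum_{j=1}^N\frac{\int_{\Omega_{h,k}}\mathbf v\,\varphi_j\,dx}{\int_{\Omega_{h,k}}\varphi_j\,dx}\,\varphi_j,\qquad s_{h,k}(u,v)=\int_{\Omega_{h,k}}(\nabla u-\mathcal P_k\nabla u)\cdot\nabla v\,dx .$$ **Claim.** Consider the estimate $$\|\nabla u\|^2_{L^2(\Omega_{h,k})}\le c\,\bigl(\|\nabla u\|^2_{L^2(\Omega_k)}+s_{h,k}(u,u)\bigr)\qquad\text{for all }u\in H^1(\Omega_{h,k}),\ k=1,2. \tag{$*$}$$ 1. There is a constant $c>0$ that depends only on $d,\sigma,\tau,C$ such that for every $\Omega,\Omega_1,\Omega_2,\Gamma$ as above there is $h_0>0$ such that $(*)$ holds with this $c$ for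 all $\mathcal T_h$, $h$, $\delta$ as above with $h\le h_0$. 2. For every $\Omega,\Omega_1,\Omega_2,\Gamma$ as above there is a constant $c'>0$ such that $(*)$ holds with $c'$ in place of $c$ for all $\mathcal T_h$, $h$, $\delta$ as above, without a restriction on $h$. In both cases the constant depends neither on $h$ nor on how $\Gamma$ cuts the simplices of the mesh. -/

import Mathlib

open MeasureTheory Metric
open scoped ContDiff RealInnerProductSpace

noncomputable section

namespace PG

/-- `ℝ^d` with the Euclidean norm. -/
abbrev Eucl (d : ℕ) : Type := EuclideanSpace ℝ (Fin d)

variable {d : ℕ}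

/-! ### Geometry: the domain, the subdomains and the interface -/

/-- A bounded Lipschitz domain: open, connected, bounded and, near each boundary point, in the
direction of a suitable unit vector `e`, the set above the graph of a Lipschitz function `g` of the
component `y - ⟪e, y⟫ e` orthogonal to `e`. -/
structure IsBoundedLipschitzDomain (Ω : Set (Eucl d)) : Prop where
  isOpen : IsOpen Ω
  isConnected : IsConnected Ω
  isBounded : Bornology.IsBounded Ω
  lipschitz_boundary : ∀ x ∈ frontier Ω, ∃ (e : Eucl d) (r : ℝ) (L : NNReal) (g : Eucl d → ℝ),
    ‖e‖ = 1 ∧ 0 < r ∧ LipschitzWith L g ∧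
      ∀ y ∈ ball x r, (y ∈ Ω ↔ g (y - ⟪e, y⟫ • e) < ⟪e, y⟫)

/-- `Ω` is divided by the smooth embedded interface `Γ` into the two nonempty open sets `Ω₁` and
`Ω₂`. Near each point of `Γ`, and up to the boundary of `Ω` if `Γ` reaches it, `Γ` is the zero set
in `Ω` of a smooth function `ψ` with nonvanishing gradient, which is positive in `Ω₁` and negative
in `Ω₂`. -/
structure IsSmoothInterface (Ω Ω₁ Ω₂ Γ : Set (Eucl d)) : Prop where
  isOpen₁ : IsOpen Ω₁
  isOpen₂ : IsOpen Ω₂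
  nonempty₁ : Ω₁.Nonempty
  nonempty₂ : Ω₂.Nonempty
  disjoint : Disjoint Ω₁ Ω₂
  disjoint₁ : Disjoint Ω₁ Γ
  disjoint₂ : Disjoint Ω₂ Γ
  union_eq : Ω₁ ∪ Γ ∪ Ω₂ = Ω
  smooth : ∀ x ∈ closure Γ, ∃ (U : Set (Eucl d)) (ψ : Eucl d → ℝ), IsOpen U ∧ x ∈ U ∧
    ContDiffOn ℝ ∞ ψ U ∧ (∀ y ∈ U, fderiv ℝ ψ y ≠ 0) ∧
    ∀ y ∈ U ∩ Ω, (y ∈ Ω₁ ↔ 0 < ψ y) ∧ (y ∈ Γ ↔ ψ y = 0) ∧ (y ∈ Ω₂ ↔ ψ y < 0)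

/-! ### Triangulations -/

/-- A conforming triangulation of `Ω` fitted to `Ω`: a finite simplicial complex whose
`d`-dimensional simplices cover exactly the closure of `Ω`. -/
structure Triangulation (Ω : Set (Eucl d)) extends Geometry.SimplicialComplex ℝ (Eucl d) where
  finite_faces : faces.Finite
  cover : ⋃ K ∈ {K ∈ faces | K.card = d + 1}, convexHull ℝ (K : Set (Eucl d)) = closure Ω

namespace Triangulation

variable {Ω : Set (Eucl d)} (T : Triangulation Ω)

/-- The vertex sets of the `d`-dimensional simplices; the simplex itself is `convexHull ℝ K`. -/
def cells : Finset (Finset (Eucl d)) :=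
  {K ∈ T.finite_faces.toFinset | K.card = d + 1}

/-- Shape regularity with constant `σ`: each simplex contains a ball of radius `ρ` such that
`diam K ≤ σ ρ`. -/
def IsShapeRegular (σ : ℝ) : Prop :=
  ∀ K ∈ T.cells, ∃ (x : Eucl d) (ρ : ℝ), 0 < ρ ∧
    closedBall x ρ ⊆ convexHull ℝ (K : Set (Eucl d)) ∧
    diam (convexHull ℝ (K : Set (Eucl d))) ≤ σ * ρ

/-- Quasiuniformity of mesh size `h` with constant `τ`: `diam K ≤ h ≤ τ diam K` for each `K`. -/
def IsQuasiUniform (τ h : ℝ) : Prop :=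
  ∀ K ∈ T.cells, diam (convexHull ℝ (K : Set (Eucl d))) ≤ h ∧
    h ≤ τ * diam (convexHull ℝ (K : Set (Eucl d)))

open Classical in
/-- The sub-triangulation of the simplices that meet the closed `δ`-neighbourhood of `Ωk`. -/
def subCells (Ωk : Set (Eucl d)) (δ : ℝ) : Finset (Finset (Eucl d)) :=
  {K ∈ T.cells | ∃ x ∈ convexHull ℝ (K : Set (Eucl d)), infDist x Ωk ≤ δ}

/-- The extended mesh-dependent domain `Ω_{h,k}(δ)`. -/
def extDomain (Ωk : Set (Eucl d)) (δ : ℝ) : Set (Eucl d) :=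
  interior (⋃ K ∈ T.subCells Ωk δ, convexHull ℝ (K : Set (Eucl d)))

/-! ### The lumped projection onto continuous piecewise affine functions -/

/-- `w` is the family of barycentric coordinates of `x` in some simplex that contains `x`, extended
by zero to the points that are not vertices of that simplex. -/
def IsBarycentric (x : Eucl d) (w : Eucl d → ℝ) : Prop :=
  ∃ K ∈ T.cells, (∀ q ∈ K, 0 ≤ w q) ∧ (∀ q ∉ K, w q = 0) ∧
    ∑ q ∈ K, w q = 1 ∧ ∑ q ∈ K, w q • q = x

open Classical in
/-- The Lagrange nodal (hat) function of the vertex `p`: its value at a point `x` of the mesh is the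
barycentric coordinate of `x` at `p`. It is affine on each simplex, one at `p` and zero at the other
vertices; see `hat_eq` and `hat_vertex`. -/
def hat (p x : Eucl d) : ℝ :=
  if h : ∃ w, T.IsBarycentric x w then h.choose p else 0

open Classical in
/-- The nodes of the finite element space `V_{h,k}(δ)` of continuous functions that are affine on
each simplex of the sub-triangulation and vanish on `∂Ω ∩ ∂Ω_{h,k}(δ)`: the vertices of the
sub-triangulation that are not on `∂Ω`. The functions `hat p` of these nodes form the nodal basis
of `V_{h,k}(δ)`. -/
def nodes (Ωk : Set (Eucl d)) (δ : ℝ) : Finset (Eucl d) :=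
  {p ∈ (T.subCells Ωk δ).biUnion id | p ∉ frontier Ω}

/-- The coefficient `∫ φ_p v / ∫ φ_p` of the lumped-mass projection. -/
def coeff (Ωk : Set (Eucl d)) (δ : ℝ) (v : Eucl d → Eucl d) (p : Eucl d) : Eucl d :=
  (∫ x in T.extDomain Ωk δ, T.hat p x)⁻¹ • ∫ x in T.extDomain Ωk δ, T.hat p x • v x

/-- The lumped-mass `L²` projection `𝒫_k v` of a vector field `v` into `(V_{h,k}(δ))^d`. -/
def proj (Ωk : Set (Eucl d)) (δ : ℝ) (v : Eucl d → Eucl d) (x : Eucl d) : Eucl d :=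
  ∑ p ∈ T.nodes Ωk δ, T.hat p x • T.coeff Ωk δ v p

/-- The projected gradient stabilization form `s_{h,k}(u, v) = ∫ (∇u - 𝒫_k ∇u) · ∇v`, in terms of
the gradients of its arguments. -/
def stab (Ωk : Set (Eucl d)) (δ : ℝ) (gradu gradv : Eucl d → Eucl d) : ℝ :=
  ∫ x in T.extDomain Ωk δ, ⟪gradu x - T.proj Ωk δ gradu x, gradv x⟫

end Triangulation

/-! ### Sobolev functions -/

/-- `u ∈ H¹(U)` with weak gradient `gradu`. -/
structure IsH1WithGrad (U : Set (Eucl d)) (u : Eucl d → ℝ) (gradu : Eucl d → Eucl d) : Prop where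
  memLp : MemLp u 2 (volume.restrict U)
  memLp_grad : MemLp gradu 2 (volume.restrict U)
  weak : ∀ φ : Eucl d → ℝ, ContDiff ℝ ∞ φ → HasCompactSupport φ → tsupport φ ⊆ U →
    ∀ v : Eucl d, ∫ x in U, u x * fderiv ℝ φ x v = -∫ x in U, ⟪gradu x, v⟫ * φ x

/-- The estimate `‖∇u‖²_{L²(Ω_{h,k})} ≤ c (‖∇u‖²_{L²(Ω_k)} + s_{h,k}(u, u))` for all
`u ∈ H¹(Ω_{h,k})`. -/
def Triangulation.IsCoercive {Ω : Set (Eucl d)} (T : Triangulation Ω) (Ωk : Set (Eucl d))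
    (δ c : ℝ) : Prop :=
  ∀ (u : Eucl d → ℝ) (gradu : Eucl d → Eucl d), IsH1WithGrad (T.extDomain Ωk δ) u gradu →
    ∫ x in T.extDomain Ωk δ, ‖gradu x‖ ^ 2 ≤
      c * ((∫ x in Ωk, ‖gradu x‖ ^ 2) + T.stab Ωk δ gradu gradu)

/-! ### The hat functions are well defined -/

namespace Triangulation

variable {Ω : Set (Eucl d)} (T : Triangulation Ω)

theorem mem_faces_of_mem_cells {K : Finset (Eucl d)} (hK : K ∈ T.cells) : K ∈ T.faces := by
  have h := (Finset.mem_filter.1 hK).1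
  simpa using h

theorem IsBarycentric.unique {x : Eucl d} {w w' : Eucl d → ℝ}
    (hw : T.IsBarycentric x w) (hw' : T.IsBarycentric x w') : w = w' := by
  classical
  obtain ⟨K, hK, hw0, hwK, hw1, hwx⟩ := hw
  obtain ⟨L, hL, hw0', hwL, hw1', hwx'⟩ := hw'
  have hKf := T.mem_faces_of_mem_cells hK
  have hLf := T.mem_faces_of_mem_cells hL
  have hx : x ∈ convexHull ℝ ((K ∩ L : Finset (Eucl d)) : Set (Eucl d)) := by
    rw [Finset.coe_inter]
    exact T.inter_subset_convexHull hKf hLf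
      ⟨Finset.mem_convexHull'.2 ⟨w, hw0, hw1, hwx⟩, Finset.mem_convexHull'.2 ⟨w', hw0', hw1', hwx'⟩⟩
  obtain ⟨v, -, hv1, hvx⟩ := Finset.mem_convexHull'.1 hx
  have key : ∀ (M : Finset (Eucl d)) (z : Eucl d → ℝ), M ∈ T.faces → K ∩ L ⊆ M →
      (∀ q ∉ M, z q = 0) → ∑ q ∈ M, z q = 1 → ∑ q ∈ M, z q • q = x →
      z = fun q => if q ∈ K ∩ L then v q else 0 := by
    intro M z hM hsub hzM hz1 hzx
    have e1 : ∑ q ∈ M, (if q ∈ K ∩ L then v q else 0) = 1 := by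
      rw [← hv1, ← Finset.sum_filter, Finset.filter_mem_eq_inter, Finset.inter_eq_right.2 hsub]
    have e2 : ∑ q ∈ M, (if q ∈ K ∩ L then v q else 0) • q = x := by
      simp only [ite_smul, zero_smul]
      rw [← hvx, ← Finset.sum_filter, Finset.filter_mem_eq_inter, Finset.inter_eq_right.2 hsub]
    have h := (T.indep hM).eq_zero_of_sum_eq_zero_subtype
      (w := fun q => z q - if q ∈ K ∩ L then v q else 0)
      (by rw [Finset.sum_sub_distrib, hz1, e1, sub_self])
      (by simp only [sub_smul]; rw [Finset.sum_sub_distrib, hzx, e2, sub_self])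
    funext q
    by_cases hq : q ∈ M
    · exact sub_eq_zero.1 (h q hq)
    · rw [hzM q hq, if_neg fun hq' => hq (hsub hq')]
  rw [key K w hKf Finset.inter_subset_left hwK hw1 hwx,
    key L w' hLf Finset.inter_subset_right hwL hw1' hwx']

/-- On each simplex, `hat p` is the barycentric coordinate at `p`. -/
theorem hat_eq {x : Eucl d} {w : Eucl d → ℝ} (hw : T.IsBarycentric x w) (p : Eucl d) :
    T.hat p x = w p := by
  have h : ∃ w, T.IsBarycentric x w := ⟨w, hw⟩
  rw [hat, dif_pos h, IsBarycentric.unique T h.choose_spec hw]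

open Classical in
/-- The hat functions are one at their own vertex and zero at the others. -/
theorem hat_vertex {K : Finset (Eucl d)} (hK : K ∈ T.cells) {q : Eucl d} (hq : q ∈ K)
    (p : Eucl d) : T.hat p q = if p = q then 1 else 0 := by
  refine T.hat_eq (w := fun p => if p = q then 1 else 0) ⟨K, hK, ?_, ?_, ?_, ?_⟩ p
  · intro r _; dsimp only; split_ifs <;> norm_num
  · intro r hr; exact if_neg (fun h : r = q => hr (by rw [h]; exact hq))
  · simp [hq]
  · simp [hq]

end Triangulation

end PG

end

/-!
The coefficient of `φ_p` in `𝒫_k ∇u` is the average of `∇u` with weight `φ_p`. If the nodal values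
are extended by zero to the vertices on `∂Ω`, it follows that `s_{h,k}(u, u)` is the integral of
`∑_p φ_p |∇u - (𝒫_k ∇u)(p)|²`. On a cell this controls the deviation of `∇u` from each of the
nodal values, hence also the differences between the nodal values. From any point of a cell of
`Ω_{h,k}` a segment of length at most `δ` leads to the closure of `Ω_k` or to `∂Ω`, and the cells
that it meets form a chain whose length is bounded because the cells contain balls of radius
proportional to `h`. If the chain stops at `∂Ω`, it reaches a vertex whose nodal value is zero.
Otherwise it reaches a vertex `p` whose star contains a ball of radius proportional to `h` around
a point of the closure of `Ω_k`. As the interface is smooth, a fixed fraction of that ball lies in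
`Ω_k`, hence so does a fixed fraction of some cell at `p`, on which `∇u` is controlled by its norm
on `Ω_k`. So the nodal values on each cell are bounded by the energy nearby, and the sum over the
cells has bounded overlap.
-/

noncomputable section

namespace PG

local notation "Δ[" K "]" => convexHull ℝ (SetLike.coe (K : Finset _))

/-! ### Chains of closed sets -/

section Chains

variable {X ι M : Type*}

/-- The graph on the indices of a family of sets in which two distinct indices are adjacent when
their sets intersect. -/
def intersectionGraph (F : ι → Set X) : SimpleGraph ι :=
  SimpleGraph.fromRel fun i j => (F i ∩ F j).Nonempty

theorem intersectionGraph_adj {F : ι → Set X} {i j : ι} :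
    (intersectionGraph F).Adj i j ↔ i ≠ j ∧ (F i ∩ F j).Nonempty := by
  rw [intersectionGraph, SimpleGraph.fromRel_adj, Set.inter_comm (F j), or_self]

theorem preconnected_intersectionGraph [TopologicalSpace X] [Finite ι] {S : Set X}
    (hS : IsPreconnected S) {F : ι → Set X} (hF : ∀ i, IsClosed (F i)) (hcov : S ⊆ ⋃ i, F i)
    (hne : ∀ i, (S ∩ F i).Nonempty) : (intersectionGraph F).Preconnected := by
  intro a b
  by_contra hab
  let R : Set ι := {c | (intersectionGraph F).Reachable a c}
  have hclosed (P : Set ι) : IsClosed (⋃ c ∈ P, F c) :=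
    P.toFinite.isClosed_biUnion fun c _ => hF c
  have hsplit : S ⊆ (⋃ c ∈ R, F c) ∪ ⋃ c ∈ Rᶜ, F c := by
    rwa [← Set.biUnion_union, Set.union_compl_self, Set.biUnion_univ]
  have hmeet {P : Set ι} {c : ι} (hc : c ∈ P) : (S ∩ ⋃ c ∈ P, F c).Nonempty :=
    (hne c).mono (Set.inter_subset_inter_right S (Set.subset_biUnion_of_mem hc))
  obtain ⟨x, -, hxR, hxRc⟩ := isPreconnected_closed_iff.1 hS _ _ (hclosed R) (hclosed Rᶜ) hsplit
    (hmeet (SimpleGraph.Reachable.refl a)) (hmeet hab)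
  obtain ⟨c, hc, hxc⟩ := Set.mem_iUnion₂.1 hxR
  obtain ⟨e, he, hxe⟩ := Set.mem_iUnion₂.1 hxRc
  have hce : c ≠ e := fun h => he (h ▸ hc)
  exact he (hc.trans (intersectionGraph_adj.2 ⟨hce, x, hxc, hxe⟩).reachable)

variable [PseudoMetricSpace M]

theorem dist_le_length_add_one_mul {G : SimpleGraph ι} {V : ι → Set M} {D : ℝ}
    (hD : ∀ i, ∀ u ∈ V i, ∀ v ∈ V i, dist u v ≤ D)
    (hV : ∀ i j, G.Adj i j → (V i ∩ V j).Nonempty) {i j : ι} (w : G.Walk i j) {u v : M}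
    (hu : u ∈ V i) (hv : v ∈ V j) : dist u v ≤ (w.length + 1) * D := by
  induction w generalizing u with
  | nil => simpa using hD _ u hu v hv
  | cons hac w ih =>
    obtain ⟨m, hm, hm'⟩ := hV _ _ hac
    rw [SimpleGraph.Walk.length_cons]
    push_cast
    linarith [dist_triangle u m v, hD _ u hu m hm, ih hm' hv]

theorem dist_le_card_mul_of_isPreconnected [TopologicalSpace X] [Fintype ι] {S : Set X}
    (hS : IsPreconnected S) {F : ι → Set X} (hF : ∀ i, IsClosed (F i)) (hcov : S ⊆ ⋃ i, F i)
    (hne : ∀ i, (S ∩ F i).Nonempty) {V : ι → Set M} {D : ℝ}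
    (hD : ∀ i, ∀ u ∈ V i, ∀ v ∈ V i, dist u v ≤ D)
    (hV : ∀ i j, (F i ∩ F j).Nonempty → (V i ∩ V j).Nonempty) {i j : ι} {u v : M}
    (hu : u ∈ V i) (hv : v ∈ V j) : dist u v ≤ Fintype.card ι * D := by
  obtain ⟨w, hw⟩ := (preconnected_intersectionGraph hS hF hcov hne i j).exists_isPath
  have hlength : (w.length : ℝ) + 1 ≤ Fintype.card ι := by exact_mod_cast hw.length_lt
  have hD0 : 0 ≤ D := dist_self u ▸ hD i u hu u hu
  exact (dist_le_length_add_one_mul hD (fun a b hab => hV a b (intersectionGraph_adj.1 hab).2)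
    w hu hv).trans (mul_le_mul_of_nonneg_right hlength hD0)

end Chains

section Segments

theorem exists_forall_mem_or_notMem_interior {X : Type*} [TopologicalSpace X] {A : Set X}
    (hA : IsClosed A) {γ : ℝ → X} (hγ : Continuous γ) (h0 : γ 0 ∈ A) :
    ∃ t ∈ Set.Icc (0 : ℝ) 1, (∀ s ∈ Set.Icc 0 t, γ s ∈ A) ∧ (t = 1 ∨ γ t ∉ interior A) := by
  let B : Set ℝ := Set.Icc 0 1 ∩ ({1} ∪ γ ⁻¹' (interior A)ᶜ)
  have hB : IsCompact B := isCompact_Icc.inter_right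
    (isClosed_singleton.union (isOpen_interior.isClosed_compl.preimage hγ))
  obtain ⟨t, ⟨ht, htA⟩, hmin⟩ := hB.exists_isLeast ⟨1, by simp [B]⟩
  refine ⟨t, ht, ?_, htA⟩
  have hbefore : Set.Ico 0 t ⊆ γ ⁻¹' A := by
    intro s hs
    by_contra h
    have hsB : s ∈ B :=
      ⟨⟨hs.1, hs.2.le.trans ht.2⟩, Or.inr fun h' => h (interior_subset (s := A) h')⟩
    exact (hmin hsB).not_gt hs.2
  rcases ht.1.eq_or_lt with rfl | ht0
  · rintro s ⟨hs, hs'⟩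
    rwa [le_antisymm hs' hs]
  · rw [← closure_Ico ht0.ne]
    exact closure_minimal hbefore (hA.preimage hγ)

variable {E : Type*} [NormedAddCommGroup E] [NormedSpace ℝ E]

theorem exists_segment_subset_or_notMem_interior {A : Set E} (hA : IsClosed A) {x : E}
    (hx : x ∈ A) (y : E) :
    ∃ z ∈ segment ℝ x y, segment ℝ x z ⊆ A ∧ (z = y ∨ z ∉ interior A) := by
  obtain ⟨t, ht, htA, hend⟩ := exists_forall_mem_or_notMem_interior hA
    (AffineMap.lineMap_continuous (p := x) (q := y)) (by simpa using hx)
  refine ⟨AffineMap.lineMap x y t, segment_eq_image_lineMap ℝ x y ▸ ⟨t, ht, rfl⟩, ?_,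
    hend.imp_left fun h => by simp [h]⟩
  rw [segment_eq_image_lineMap]
  rintro _ ⟨s, hs, rfl⟩
  have hst : AffineMap.lineMap x (AffineMap.lineMap x y t) s = AffineMap.lineMap x y (s * t) := by
    simp only [AffineMap.lineMap_apply_module]
    module
  rw [hst]
  exact htA _ ⟨mul_nonneg hs.1 ht.1, mul_le_of_le_one_left ht.1 hs.2⟩

theorem dist_le_mul_dist_of_segment_subset_iUnion {ι M : Type*} [Finite ι] [PseudoMetricSpace M]
    {F : ι → Set E} (hF : ∀ i, IsClosed (F i)) {g : E → M} {C : NNReal}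
    (hg : ∀ i, LipschitzOnWith C g (F i)) {x y : E} (hxy : segment ℝ x y ⊆ ⋃ i, F i) :
    dist (g x) (g y) ≤ C * dist x y := by
  let γ : ℝ → E := AffineMap.lineMap x y
  have hγ : Continuous γ := AffineMap.lineMap_continuous
  have hγI (t : ℝ) (ht : t ∈ Set.Icc (0 : ℝ) 1) : γ t ∈ ⋃ i, F i :=
    hxy (segment_eq_image_lineMap ℝ x y ▸ ⟨t, ht, rfl⟩)
  have hgγ : ContinuousOn (g ∘ γ) (Set.Icc 0 1) :=
    ((locallyFinite_of_finite F).continuousOn_iUnion hF fun i => (hg i).continuousOn).comp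
      hγ.continuousOn hγI
  let S : Set ℝ := {t | dist (g (γ 0)) (g (γ t)) ≤ C * (t * dist x y)}
  have hS : IsClosed (S ∩ Set.Icc 0 1) := by
    have hdist : ContinuousOn (fun t => dist (g (γ 0)) (g (γ t))) (Set.Icc 0 1) :=
      (continuous_const.dist continuous_id).comp_continuousOn hgγ
    have hbound : ContinuousOn (fun t => C * (t * dist x y)) (Set.Icc 0 1) := by fun_prop
    exact Set.inter_comm S _ ▸ isClosed_Icc.isClosed_le hdist hbound
  suffices hSI : Set.Icc (0 : ℝ) 1 ⊆ S by
    simpa [S, γ] using hSI (Set.right_mem_Icc.2 zero_le_one)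
  refine hS.Icc_subset_of_forall_mem_nhdsWithin (by simp [S]) ?_
  rintro t ⟨ht, ht0, ht1⟩
  have hnear : ∀ᶠ r in nhds t, ∀ i, γ r ∈ F i → γ t ∈ F i := by
    refine Filter.eventually_all.2 fun i => ?_
    by_cases hi : γ t ∈ F i
    · exact Filter.Eventually.of_forall fun _ _ => hi
    · filter_upwards [hγ.continuousAt ((hF i).isOpen_compl.mem_nhds hi)] with r hr hr'
      exact absurd hr' hr
  filter_upwards [nhdsWithin_le_nhds hnear, Ioo_mem_nhdsGT ht1] with r hr hrt
  obtain ⟨i, hi⟩ := Set.mem_iUnion.1 (hγI r ⟨ht0.trans hrt.1.le, hrt.2.le⟩)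
  have hstep := (hg i).dist_le_mul _ (hr i hi) _ hi
  rw [dist_lineMap_lineMap, dist_comm t, Real.dist_eq, abs_of_pos (sub_pos.2 hrt.1)] at hstep
  have ht' : dist (g (γ 0)) (g (γ t)) ≤ C * (t * dist x y) := ht
  change dist (g (γ 0)) (g (γ r)) ≤ C * (r * dist x y)
  linarith [dist_triangle (g (γ 0)) (g (γ t)) (g (γ r))]

end Segments

/-! ### Interior balls -/

section InteriorBalls

/-- The interior ball condition of `D` in `Ω` at scale `r`: every ball of radius `r` that is
contained in `Ω` and centred in the closure of `D` contains a ball of radius `s` in `D`. For an open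
set cut out of `Ω` by a smooth interface it holds with `s = r / 4` for all small `r`. -/
def HasInteriorBalls {X : Type*} [PseudoMetricSpace X] (Ω D : Set X) (r s : ℝ) : Prop :=
  ∀ y ∈ closure D, ball y r ⊆ Ω → ∃ z, ball z s ⊆ D ∩ ball y r

/-- A nonempty open subset `D` of `Ω` that satisfies the interior ball condition with `s = κ r` at
all scales `r ≤ r₀`. The coercivity estimate uses nothing else about the subdomain. -/
structure IsInteriorBallSubdomain {X : Type*} [PseudoMetricSpace X] (Ω D : Set X) (κ r₀ : ℝ) :
    Prop where
  isOpen : IsOpen D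
  nonempty : D.Nonempty
  subset : D ⊆ Ω
  hasInteriorBalls : ∀ r, 0 < r → r ≤ r₀ → HasInteriorBalls Ω D r (κ * r)

theorem IsInteriorBallSubdomain.mono {X : Type*} [PseudoMetricSpace X] {Ω D : Set X}
    {κ r₀ r₁ : ℝ} (hD : IsInteriorBallSubdomain Ω D κ r₀) (h : r₁ ≤ r₀) :
    IsInteriorBallSubdomain Ω D κ r₁ :=
  { hD with hasInteriorBalls := fun r hr hrr => hD.hasInteriorBalls r hr (hrr.trans h) }

theorem exists_mem_ball_lt_apply {E : Type*} [NormedAddCommGroup E] [NormedSpace ℝ E]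
    {L : E →L[ℝ] ℝ} {a : ℝ} (ha : a < ‖L‖) : ∃ v ∈ ball (0 : E) 1, a < L v := by
  obtain ⟨v, hv, hLv⟩ := L.exists_lt_apply_of_lt_opNorm ha
  rcases le_total 0 (L v) with h | h
  · exact ⟨v, mem_ball_zero_iff.2 hv, by rwa [Real.norm_of_nonneg h] at hLv⟩
  · exact ⟨-v, by simpa using hv, by rwa [Real.norm_of_nonpos h, ← map_neg] at hLv⟩

/-- Moving by `r / 2` in a direction in which `L` nearly attains its norm increases `ψ` by almost
`‖L‖ r / 2`, which dominates the linearization error and a further displacement by `r / 4`. -/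
theorem exists_forall_ball_subset_pos {E : Type*} [NormedAddCommGroup E] [NormedSpace ℝ E]
    {ψ : E → ℝ} {L : E →L[ℝ] ℝ} {x : E} (hψ : HasStrictFDerivAt ψ L x) (hL : L ≠ 0) :
    ∃ ε > 0, ∀ y r, 0 < r → ball y r ⊆ ball x ε → 0 ≤ ψ y →
      ∃ z, ball z (r / 4) ⊆ ball y r ∩ {w | 0 < ψ w} := by
  have hL0 : 0 < ‖L‖ := norm_pos_iff.2 hL
  obtain ⟨v, hv, hLv⟩ := exists_mem_ball_lt_apply (show 15 / 16 * ‖L‖ < ‖L‖ by linarith)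
  rw [mem_ball_zero_iff] at hv
  obtain ⟨U, hU, hlin⟩ := hψ.approximates_deriv_on_nhds (c := ‖L‖₊ / 4)
    (Or.inr (by simpa using hL))
  obtain ⟨ε, hε, hεU⟩ := Metric.mem_nhds_iff.1 hU
  refine ⟨ε, hε, fun y r hr hyr hy => ⟨y + (r / 2) • v, fun w hw => ?_⟩⟩
  obtain ⟨e, he, rfl⟩ : ∃ e, ‖e‖ < r / 4 ∧ w = y + ((r / 2) • v + e) :=
    ⟨w - (y + (r / 2) • v), by simpa [dist_eq_norm] using hw, by abel⟩
  set u := (r / 2) • v + e with hu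
  have hu_norm : ‖u‖ < 3 / 4 * r := by
    have hv' : ‖(r / 2) • v‖ < r / 2 := by
      rw [norm_smul, Real.norm_of_nonneg (by positivity)]
      nlinarith
    linarith [norm_add_le ((r / 2) • v) e]
  have hmem : y + u ∈ ball y r := by
    rw [mem_ball, dist_eq_norm, add_sub_cancel_left]
    linarith
  refine ⟨hmem, ?_⟩
  have hLu : 7 / 32 * r * ‖L‖ < L u := by
    have hLe := neg_le_of_abs_le (L.le_opNorm e)
    rw [hu, map_add, map_smul, smul_eq_mul]
    nlinarith
  have herr := hlin _ (hεU (hyr hmem)) _ (hεU (hyr (mem_ball_self hr)))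
  rw [add_sub_cancel_left] at herr
  have herr' := neg_le_of_abs_le herr
  simp only [NNReal.coe_div, coe_nnnorm, NNReal.coe_ofNat] at herr'
  change 0 < ψ (y + u)
  nlinarith

variable {d : ℕ} {Ω Ω₁ Ω₂ Γ : Set (Eucl d)}

/-- Below the graph there are no points of `Ω`, so that moving down from a boundary point leaves the
closure of `Ω`. -/
theorem IsBoundedLipschitzDomain.interior_closure_subset (hΩ : IsBoundedLipschitzDomain Ω) :
    interior (closure Ω) ⊆ Ω := by
  intro x hx
  by_contra hxΩ
  have hx_frontier : x ∈ frontier Ω := ⟨interior_subset hx, by rwa [hΩ.isOpen.interior_eq]⟩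
  obtain ⟨e, r, L, g, he, hr, hg, hmem⟩ := hΩ.lipschitz_boundary x hx_frontier
  let below : Set (Eucl d) := {y | ⟪e, y⟫ < g (y - ⟪e, y⟫ • e)}
  have hbelow : IsOpen below := isOpen_lt (by fun_prop) (hg.continuous.comp (by fun_prop))
  have hdisj : Disjoint (closure Ω) (below ∩ ball x r) := by
    refine Disjoint.closure_left (Set.disjoint_left.2 ?_) (hbelow.inter isOpen_ball)
    rintro y hy ⟨hyA, hyb⟩
    exact lt_asymm hyA ((hmem y hyb).1 hy)
  have hxg : ⟪e, x⟫ ≤ g (x - ⟪e, x⟫ • e) :=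
    not_lt.1 (mt (hmem x (mem_ball_self hr)).2 hxΩ)
  have htendsto : Filter.Tendsto (fun t : ℝ => x - t • e) (nhdsWithin 0 (Set.Ioi 0)) (nhds x) := by
    have hcont : Continuous fun t : ℝ => x - t • e := by fun_prop
    simpa using (hcont.tendsto 0).mono_left nhdsWithin_le_nhds
  obtain ⟨t, ⟨htΩ, htball⟩, ht⟩ :=
    ((htendsto.eventually (Filter.inter_mem (mem_interior_iff_mem_nhds.1 hx)
      (ball_mem_nhds x hr))).and self_mem_nhdsWithin).exists
  refine Set.disjoint_left.1 hdisj htΩ ⟨?_, htball⟩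
  have hinner : ⟪e, x - t • e⟫ = ⟪e, x⟫ - t := by
    rw [inner_sub_right, real_inner_smul_right, real_inner_self_eq_norm_sq, he, one_pow, mul_one]
  have hproj : x - t • e - (⟪e, x⟫ - t) • e = x - ⟪e, x⟫ • e := by module
  change ⟪e, x - t • e⟫ < g (x - t • e - ⟪e, x - t • e⟫ • e)
  rw [hinner, hproj]
  linarith [ht]

namespace IsSmoothInterface

theorem symm (hI : IsSmoothInterface Ω Ω₁ Ω₂ Γ) : IsSmoothInterface Ω Ω₂ Ω₁ Γ where
  isOpen₁ := hI.isOpen₂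
  isOpen₂ := hI.isOpen₁
  nonempty₁ := hI.nonempty₂
  nonempty₂ := hI.nonempty₁
  disjoint := hI.disjoint.symm
  disjoint₁ := hI.disjoint₂
  disjoint₂ := hI.disjoint₁
  union_eq := by rw [← hI.union_eq, Set.union_comm, Set.union_comm Ω₂, Set.union_assoc]
  smooth := by
    intro x hx
    obtain ⟨U, ψ, hU, hxU, hψ, hdψ, hsign⟩ := hI.smooth x hx
    refine ⟨U, fun y => -ψ y, hU, hxU, hψ.neg, fun y hy => ?_, fun y hy => ?_⟩
    · rw [fderiv_fun_neg]
      exact neg_ne_zero.2 (hdψ y hy)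
    · obtain ⟨h₁, hΓ, h₂⟩ := hsign y hy
      simp only [h₁, hΓ, h₂, neg_eq_zero, Left.neg_pos_iff, Left.neg_neg_iff, and_self]

theorem subset₁ (hI : IsSmoothInterface Ω Ω₁ Ω₂ Γ) : Ω₁ ⊆ Ω :=
  hI.union_eq ▸ fun _ hx => Or.inl (Or.inl hx)

theorem interface_subset (hI : IsSmoothInterface Ω Ω₁ Ω₂ Γ) : Γ ⊆ Ω :=
  hI.union_eq ▸ fun _ hx => Or.inl (Or.inr hx)

theorem exists_ball_local (hI : IsSmoothInterface Ω Ω₁ Ω₂ Γ) {x : Eucl d} (hx : x ∈ closure Γ) :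
    ∃ ε > 0, ∀ (y : Eucl d) (r : ℝ), 0 < r → ball y r ⊆ ball x ε → y ∈ closure Ω₁ →
      ball y r ⊆ Ω → ∃ z, ball z (r / 4) ⊆ Ω₁ ∩ ball y r := by
  obtain ⟨U, ψ, hU, hxU, hψ, hdψ, hsign⟩ := hI.smooth x hx
  have hstrict : HasStrictFDerivAt ψ (fderiv ℝ ψ x) x :=
    (hψ.contDiffAt (hU.mem_nhds hxU)).hasStrictFDerivAt (by simp)
  obtain ⟨ε, hε, hpos⟩ := exists_forall_ball_subset_pos hstrict (hdψ x hxU)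
  obtain ⟨ε', hε', hεU⟩ := Metric.isOpen_iff.1 hU x hxU
  refine ⟨min ε ε', lt_min hε hε', fun y r hr hyr hy hyΩ => ?_⟩
  have hyU : ball y r ⊆ U := hyr.trans ((ball_subset_ball (min_le_right _ _)).trans hεU)
  have hyψ : 0 ≤ ψ y := by
    by_contra! h
    have hy₂ : y ∈ Ω₂ :=
      (hsign y ⟨hyU (mem_ball_self hr), hyΩ (mem_ball_self hr)⟩).2.2.2 h
    exact Set.disjoint_left.1 (hI.disjoint.closure_left hI.isOpen₂) hy hy₂
  obtain ⟨z, hz⟩ := hpos y r hr (hyr.trans (ball_subset_ball (min_le_left _ _))) hyψ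
  exact ⟨z, fun w hw =>
    ⟨(hsign w ⟨hyU (hz hw).1, hyΩ (hz hw).1⟩).1.2 (hz hw).2, (hz hw).1⟩⟩

theorem ball_subset_of_disjoint (hI : IsSmoothInterface Ω Ω₁ Ω₂ Γ) {y : Eucl d} {r : ℝ}
    (hr : 0 < r) (hy : y ∈ closure Ω₁) (hyΩ : ball y r ⊆ Ω) (hyΓ : Disjoint (ball y r) Γ) :
    ball y r ⊆ Ω₁ := by
  have hsub : ball y r ⊆ Ω₁ ∪ Ω₂ := by
    intro v hv
    have hvΩ := hyΩ hv
    rw [← hI.union_eq] at hvΩ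
    exact hvΩ.imp_left fun h => h.resolve_right (Set.disjoint_left.1 hyΓ hv)
  exact (convex_ball y r).isPreconnected.subset_left_of_subset_union hI.isOpen₁ hI.isOpen₂
    hI.disjoint hsub (mem_closure_iff.1 hy _ isOpen_ball (mem_ball_self hr))

theorem exists_isInteriorBallSubdomain (hI : IsSmoothInterface Ω Ω₁ Ω₂ Γ)
    (hΩ : Bornology.IsBounded Ω) : ∃ r₀ > 0, IsInteriorBallSubdomain Ω Ω₁ (1 / 4) r₀ := by
  choose ε hε hlocal using fun x : closure Γ => hI.exists_ball_local x.2
  obtain ⟨ℓ, hℓ, hlebesgue⟩ := lebesgue_number_lemma_of_metric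
    (hΩ.subset hI.interface_subset).isCompact_closure
    (c := fun x : closure Γ => ball (x : Eucl d) (ε x)) (fun _ => isOpen_ball)
    (fun x hx => Set.mem_iUnion.2 ⟨⟨x, hx⟩, mem_ball_self (hε _)⟩)
  refine ⟨ℓ / 2, by positivity, hI.isOpen₁, hI.nonempty₁, hI.subset₁, fun r hr hrℓ y hy hyΩ => ?_⟩
  rw [one_div_mul_eq_div]
  by_cases hyΓ : Disjoint (ball y r) Γ
  · have hball : ball y (r / 4) ⊆ ball y r := ball_subset_ball (by linarith)
    exact ⟨y, fun w hw => ⟨hI.ball_subset_of_disjoint hr hy hyΩ hyΓ (hball hw), hball hw⟩⟩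
  · obtain ⟨q, hqy, hqΓ⟩ := Set.not_disjoint_iff.1 hyΓ
    obtain ⟨x, hx⟩ := hlebesgue q (subset_closure hqΓ)
    have hqr : ball y r ⊆ ball q ℓ := ball_subset_ball' (by linarith [mem_ball'.1 hqy])
    exact hlocal x y r hr (hqr.trans hx) hy hyΩ

end IsSmoothInterface

end InteriorBalls

/-! ### Barycentric coordinates -/

section Barycentric

variable {E : Type*} [NormedAddCommGroup E] [NormedSpace ℝ E]

theorem mul_sub_le_dist_mul_of_nonneg_on_closedBall {f : E →ᵃ[ℝ] ℝ} {z : E} {r : ℝ} (hr : 0 ≤ r)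
    (hf : ∀ w ∈ closedBall z r, 0 ≤ f w) (p q : E) : r * (f p - f q) ≤ dist p q * f z := by
  rcases eq_or_ne p q with rfl | hpq
  · simp
  have hD : 0 < dist p q := dist_pos.2 hpq
  set t := r / dist p q with ht
  have hmem : t • (q - p) + z ∈ closedBall z r := by
    rw [mem_closedBall, dist_eq_norm, add_sub_cancel_right, norm_smul,
      Real.norm_of_nonneg (by positivity), ← dist_eq_norm, dist_comm, ht, div_mul_cancel₀ _ hD.ne']
  have hval : f (t • (q - p) + z) = f z - t * (f p - f q) := by
    have hadd := f.map_vadd z (t • (q - p))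
    have hsub := f.linearMap_vsub q p
    simp only [vadd_eq_add, map_smul, vsub_eq_sub, smul_eq_mul] at hadd hsub
    rw [hadd, hsub]
    ring
  have hle : t * (f p - f q) ≤ f z := sub_nonneg.1 (hval ▸ hf _ hmem)
  rwa [ht, div_mul_eq_mul_div, div_le_iff₀ hD, mul_comm (f z)] at hle

/-- `K` is the vertex set of a simplex of full dimension. -/
structure IsFullSimplex (K : Finset E) : Prop where
  affineIndependent : AffineIndependent ℝ ((↑) : K → E)
  affineSpan_eq_top : affineSpan ℝ (Set.range ((↑) : K → E)) = ⊤

open Classical in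
/-- The barycentric coordinate at `p` of the simplex with vertex set `K`, as an affine function on
the whole space; zero if `p` is not a vertex or the simplex is degenerate. -/
def bary (K : Finset E) (p : E) : E →ᵃ[ℝ] ℝ :=
  if h : IsFullSimplex K ∧ p ∈ K then
    (AffineBasis.mk _ h.1.affineIndependent h.1.affineSpan_eq_top).coord ⟨p, h.2⟩
  else 0

theorem bary_of_notMem {K : Finset E} {p : E} (hp : p ∉ K) (x : E) : bary K p x = 0 := by
  rw [bary, dif_neg fun h => hp h.2]
  rfl

theorem mem_of_bary_pos {K : Finset E} {p x : E} (h : 0 < bary K p x) : p ∈ K := by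
  by_contra hp
  exact h.ne' (bary_of_notMem hp x)

namespace IsFullSimplex

variable {K : Finset E} (hK : IsFullSimplex K)

include hK

/-- The vertices as an affine basis, to transfer Mathlib's results on barycentric coordinates. -/
def affineBasis : AffineBasis K ℝ E :=
  ⟨(↑), hK.affineIndependent, hK.affineSpan_eq_top⟩

theorem bary_eq_coord (p : K) : bary K p = hK.affineBasis.coord p := by
  rw [bary, dif_pos ⟨hK, p.2⟩]
  rfl

theorem range_affineBasis : Set.range hK.affineBasis = (K : Set E) := Subtype.range_coe

theorem sum_bary (x : E) : ∑ p ∈ K, bary K p x = 1 := by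
  rw [← Finset.sum_coe_sort, ← hK.affineBasis.sum_coord_apply_eq_one x]
  simp_rw [hK.bary_eq_coord]

theorem sum_bary_smul (x : E) : ∑ p ∈ K, bary K p x • p = x := by
  conv_rhs => rw [← hK.affineBasis.linear_combination_coord_eq_self x]
  rw [← Finset.sum_coe_sort]
  simp_rw [hK.bary_eq_coord]
  rfl

theorem mem_convexHull_iff {x : E} : x ∈ Δ[K] ↔ ∀ p ∈ K, 0 ≤ bary K p x := by
  rw [← hK.range_affineBasis, hK.affineBasis.convexHull_eq_nonneg_coord]
  simp only [Set.mem_ofPred_eq, ← hK.bary_eq_coord, Subtype.forall]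

theorem mem_interior_convexHull_iff {x : E} :
    x ∈ interior Δ[K] ↔ ∀ p ∈ K, 0 < bary K p x := by
  rw [← hK.range_affineBasis, hK.affineBasis.interior_convexHull]
  simp only [Set.mem_ofPred_eq, ← hK.bary_eq_coord, Subtype.forall]

theorem bary_self {p : E} (hp : p ∈ K) : bary K p p = 1 := by
  rw [hK.bary_eq_coord ⟨p, hp⟩]
  exact hK.affineBasis.coord_apply_eq ⟨p, hp⟩

theorem bary_of_ne {p q : E} (hq : q ∈ K) (hpq : p ≠ q) : bary K p q = 0 := by
  by_cases hp : p ∈ K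
  · rw [hK.bary_eq_coord ⟨p, hp⟩]
    exact hK.affineBasis.coord_apply_ne (j := ⟨q, hq⟩) fun h => hpq (congrArg Subtype.val h)
  · exact bary_of_notMem hp q

theorem bary_nonneg {x : E} (hx : x ∈ Δ[K]) (p : E) : 0 ≤ bary K p x := by
  by_cases hp : p ∈ K
  · exact hK.mem_convexHull_iff.1 hx p hp
  · exact (bary_of_notMem hp x).ge

theorem bary_le_one {x : E} (hx : x ∈ Δ[K]) (p : E) : bary K p x ≤ 1 := by
  by_cases hp : p ∈ K
  · rw [← hK.sum_bary x]
    exact Finset.single_le_sum (f := fun q => bary K q x) (fun q _ => hK.bary_nonneg hx q) hp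
  · exact (bary_of_notMem hp x).trans_le zero_le_one

theorem exists_inv_card_le_bary (x : E) : ∃ p ∈ K, (K.card : ℝ)⁻¹ ≤ bary K p x := by
  by_contra! h
  have hne : K.Nonempty := Finset.nonempty_of_ne_empty fun h0 => by
    simpa [h0] using hK.sum_bary x
  have hlt := Finset.sum_lt_sum_of_nonempty hne h
  rw [hK.sum_bary, Finset.sum_const, nsmul_eq_mul,
    mul_inv_cancel₀ (Nat.cast_ne_zero.2 hne.card_ne_zero)] at hlt
  exact lt_irrefl _ hlt

theorem bary_lineMap_vertex {p : E} (hp : p ∈ K) (x : E) (t : ℝ) :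
    bary K p (AffineMap.lineMap p x t) = 1 - t * (1 - bary K p x) := by
  rw [AffineMap.apply_lineMap, hK.bary_self hp, AffineMap.lineMap_apply_module, smul_eq_mul,
    smul_eq_mul]
  ring

theorem mem_convexHull_of_lineMap_mem {p z : E} (hp : p ∈ K) {t : ℝ} (ht : 0 < t)
    (hz : AffineMap.lineMap p z t ∈ Δ[K]) (hpz : 0 ≤ bary K p z) : z ∈ Δ[K] := by
  refine hK.mem_convexHull_iff.2 fun q _ => ?_
  rcases eq_or_ne q p with rfl | hqp
  · exact hpz
  · have hqz := hK.bary_nonneg hz q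
    rw [AffineMap.apply_lineMap, hK.bary_of_ne hp hqp, AffineMap.lineMap_apply_module, smul_zero,
      zero_add] at hqz
    exact nonneg_of_mul_nonneg_right hqz ht

theorem nontrivial [Nontrivial E] : K.Nontrivial := by
  have hspan := hK.affineSpan_eq_top
  rw [Subtype.range_coe] at hspan
  refine Set.not_subsingleton_iff.1 fun h => ?_
  exact not_subsingleton E (AffineSubspace.subsingleton_of_subsingleton_span_eq_top h hspan)

theorem diam_pos [Nontrivial E] : 0 < diam Δ[K] := by
  rw [convexHull_diam]
  exact Metric.diam_pos hK.nontrivial K.finite_toSet.isBounded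

theorem le_diam_mul_bary [Nontrivial E] {z : E} {r : ℝ} (hr : 0 ≤ r)
    (hz : closedBall z r ⊆ Δ[K]) {p : E} (hp : p ∈ K) : r ≤ diam Δ[K] * bary K p z := by
  obtain ⟨q, hq, hqp⟩ := hK.nontrivial.exists_ne p
  have hle := mul_sub_le_dist_mul_of_nonneg_on_closedBall hr
    (fun w hw => hK.bary_nonneg (hz hw) p) p q
  rw [hK.bary_self hp, hK.bary_of_ne hq hqp.symm, sub_zero, mul_one] at hle
  refine hle.trans (mul_le_mul_of_nonneg_right ?_
    (hK.bary_nonneg (hz (mem_closedBall_self hr)) p))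
  rw [convexHull_diam]
  exact dist_le_diam_of_mem K.finite_toSet.isBounded hp hq

theorem lipschitzWith_bary {c : E} {ρ : ℝ} (hρ : 0 < ρ) (hc : closedBall c ρ ⊆ Δ[K]) (p : E) :
    LipschitzWith ρ⁻¹.toNNReal (bary K p) := by
  refine LipschitzWith.of_dist_le' fun u v => ?_
  have hcK : c ∈ Δ[K] := hc (mem_closedBall_self hρ.le)
  have hle (a b : E) : ρ * (bary K p a - bary K p b) ≤ dist a b :=
    (mul_sub_le_dist_mul_of_nonneg_on_closedBall hρ.le
      (fun w hw => hK.bary_nonneg (hc hw) p) a b).trans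
      (mul_le_of_le_one_right dist_nonneg (hK.bary_le_one hcK p))
  have huv := hle u v
  have hvu := hle v u
  rw [dist_comm v u] at hvu
  rw [Real.dist_eq, inv_mul_eq_div, le_div_iff₀ hρ, mul_comm, ← abs_of_pos hρ, ← abs_mul,
    abs_le]
  exact ⟨by linarith, huv⟩

end IsFullSimplex

theorem continuous_bary [FiniteDimensional ℝ E] (K : Finset E) (p : E) : Continuous (bary K p) :=
  AffineMap.continuous_of_finiteDimensional _

end Barycentric

/-! ### Triangulations -/

namespace Triangulation

variable {d : ℕ} {Ω : Set (Eucl d)} {T : Triangulation Ω} {K L : Finset (Eucl d)}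

theorem card_of_mem_cells (hK : K ∈ T.cells) : K.card = d + 1 :=
  (Finset.mem_filter.1 hK).2

theorem nonempty_of_mem_cells (hK : K ∈ T.cells) : K.Nonempty :=
  Finset.card_pos.1 (by rw [card_of_mem_cells hK]; exact Nat.succ_pos d)

theorem isFullSimplex (hK : K ∈ T.cells) : IsFullSimplex K where
  affineIndependent := T.indep (T.mem_faces_of_mem_cells hK)
  affineSpan_eq_top := by
    rw [(T.indep (T.mem_faces_of_mem_cells hK)).affineSpan_eq_top_iff_card_eq_finrank_add_one]
    simp [card_of_mem_cells hK]

theorem mem_closure_iff {x : Eucl d} : x ∈ closure Ω ↔ ∃ K ∈ T.cells, x ∈ Δ[K] := by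
  rw [← T.cover]
  simp [cells]

theorem convexHull_subset_closure (hK : K ∈ T.cells) : Δ[K] ⊆ closure Ω :=
  fun _ hx => mem_closure_iff.2 ⟨K, hK, hx⟩

theorem hat_eq_bary (hK : K ∈ T.cells) {x : Eucl d} (hx : x ∈ Δ[K]) (p : Eucl d) :
    T.hat p x = bary K p x :=
  T.hat_eq (w := fun p => bary K p x)
    ⟨K, hK, (isFullSimplex hK).mem_convexHull_iff.1 hx, fun _ hq => bary_of_notMem hq x,
      (isFullSimplex hK).sum_bary x, (isFullSimplex hK).sum_bary_smul x⟩ p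

theorem bary_eq_bary (hK : K ∈ T.cells) (hL : L ∈ T.cells) {x : Eucl d} (hxK : x ∈ Δ[K])
    (hxL : x ∈ Δ[L]) (p : Eucl d) : bary K p x = bary L p x := by
  rw [← hat_eq_bary hK hxK, hat_eq_bary hL hxL]

theorem sum_hat (hK : K ∈ T.cells) {x : Eucl d} (hx : x ∈ Δ[K]) : ∑ p ∈ K, T.hat p x = 1 := by
  simp only [hat_eq_bary hK hx, (isFullSimplex hK).sum_bary]

theorem hat_of_notMem (hK : K ∈ T.cells) {x p : Eucl d} (hx : x ∈ Δ[K]) (hp : p ∉ K) :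
    T.hat p x = 0 := by
  rw [hat_eq_bary hK hx, bary_of_notMem hp]

theorem hat_nonneg {x : Eucl d} (hx : x ∈ closure Ω) (p : Eucl d) : 0 ≤ T.hat p x := by
  obtain ⟨K, hK, hxK⟩ := (mem_closure_iff (T := T)).1 hx
  exact (hat_eq_bary hK hxK p).symm ▸ (isFullSimplex hK).bary_nonneg hxK p

theorem hat_le_one {x : Eucl d} (hx : x ∈ closure Ω) (p : Eucl d) : T.hat p x ≤ 1 := by
  obtain ⟨K, hK, hxK⟩ := (mem_closure_iff (T := T)).1 hx
  exact (hat_eq_bary hK hxK p).symm ▸ (isFullSimplex hK).bary_le_one hxK p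

theorem exists_mem_inter (hK : K ∈ T.cells) (hL : L ∈ T.cells)
    (h : (Δ[K] ∩ Δ[L]).Nonempty) : ((K : Set (Eucl d)) ∩ L).Nonempty := by
  obtain ⟨x, hx⟩ := h
  exact convexHull_nonempty_iff.1
    ⟨x, T.inter_subset_convexHull (T.mem_faces_of_mem_cells hK) (T.mem_faces_of_mem_cells hL) hx⟩

theorem disjoint_interior (hK : K ∈ T.cells) (hL : L ∈ T.cells) (hKL : K ≠ L) :
    Disjoint (interior Δ[K]) (interior Δ[L]) := by
  obtain ⟨p, hp, hpL⟩ : ∃ p ∈ K, p ∉ L := by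
    by_contra! h
    exact hKL (Finset.eq_of_subset_of_card_le h
      (by rw [card_of_mem_cells hK, card_of_mem_cells hL]))
  refine Set.disjoint_left.2 fun x hxK hxL => ?_
  have hpos := (isFullSimplex hK).mem_interior_convexHull_iff.1 hxK p hp
  rw [bary_eq_bary hK hL (interior_subset hxK) (interior_subset hxL), bary_of_notMem hpL] at hpos
  exact lt_irrefl _ hpos

variable (T) in
/-- The star of a vertex `p`: the union of the cells with vertex `p`. It is the support of the hat
function of `p`. -/
def star (p : Eucl d) : Set (Eucl d) :=
  ⋃ K ∈ {K ∈ T.cells | p ∈ K}, Δ[K]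

theorem mem_star_iff {p x : Eucl d} : x ∈ T.star p ↔ ∃ K ∈ T.cells, p ∈ K ∧ x ∈ Δ[K] := by
  simp [star, and_assoc]

theorem convexHull_subset_star {p : Eucl d} (hK : K ∈ T.cells) (hp : p ∈ K) :
    Δ[K] ⊆ T.star p := fun _ hx => mem_star_iff.2 ⟨K, hK, hp, hx⟩

theorem isClosed_star (p : Eucl d) : IsClosed (T.star p) :=
  isClosed_biUnion_finset fun K _ => K.finite_toSet.isClosed_convexHull ℝ

theorem star_subset_closure (p : Eucl d) : T.star p ⊆ closure Ω := fun _ hx => by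
  obtain ⟨K, hK, -, hxK⟩ := mem_star_iff.1 hx
  exact convexHull_subset_closure hK hxK

variable (T) in
theorem eventually_forall_mem_cell_imp (x : Eucl d) :
    ∀ᶠ z in nhds x, ∀ L ∈ T.cells, z ∈ Δ[L] → x ∈ Δ[L] := by
  rw [Filter.eventually_all_finset]
  intro L _
  by_cases hx : x ∈ Δ[L]
  · exact Filter.Eventually.of_forall fun _ _ => hx
  · filter_upwards [(L.finite_toSet.isClosed_convexHull ℝ).isOpen_compl.mem_nhds hx] with z hz hz'
    exact absurd hz' hz

variable (T) in
theorem eventually_forall_bary_pos (p x : Eucl d) :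
    ∀ᶠ z in nhds x, ∀ L ∈ T.cells, 0 < bary L p x → 0 < bary L p z := by
  rw [Filter.eventually_all_finset]
  intro L _
  by_cases h : 0 < bary L p x
  · filter_upwards [(continuous_bary L p).continuousAt.eventually (lt_mem_nhds h)] with z hz _
    exact hz
  · exact Filter.Eventually.of_forall fun _ h' => absurd h' h

theorem exists_lineMap_mem_interior_closure {p : Eucl d} (hp : p ∈ interior (closure Ω))
    (x : Eucl d) : ∃ t ∈ Set.Ioc (0 : ℝ) 1, AffineMap.lineMap p x t ∈ interior (closure Ω) := by
  have htendsto : Filter.Tendsto (fun t : ℝ => AffineMap.lineMap p x t)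
      (nhdsWithin 0 (Set.Ioi 0)) (nhds p) := by
    have hcont : Continuous fun t : ℝ => AffineMap.lineMap p x t := AffineMap.lineMap_continuous
    simpa using (hcont.tendsto 0).mono_left nhdsWithin_le_nhds
  obtain ⟨t, hmem, ht⟩ := ((htendsto.eventually (isOpen_interior.mem_nhds hp)).and
    (Ioc_mem_nhdsGT (zero_lt_one' ℝ))).exists
  exact ⟨t, ht, hmem⟩

/-- Contracting towards `p` moves `x` into the interior of the mesh without leaving the star of `p`.
The points near the contracted point lie in cells that contain it, hence in cells with vertex `p`,
and these cells are conical at `p` near `x`. -/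
theorem star_mem_nhds {p x : Eucl d} (hp : p ∈ interior (closure Ω)) (hx : x ∈ closure Ω)
    (hpx : 0 < T.hat p x) : T.star p ∈ nhds x := by
  obtain ⟨K, hK, hxK⟩ := (mem_closure_iff (T := T)).1 hx
  rw [hat_eq_bary hK hxK] at hpx
  have hpK : p ∈ K := mem_of_bary_pos hpx
  obtain ⟨t, ⟨ht0, ht1⟩, hxt⟩ := exists_lineMap_mem_interior_closure hp x
  have hxtK : AffineMap.lineMap p x t ∈ Δ[K] :=
    (convex_convexHull ℝ _).lineMap_mem (subset_convexHull ℝ _ hpK) hxK ⟨ht0.le, ht1⟩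
  have hcontract : Continuous fun z : Eucl d => AffineMap.lineMap p z t := by
    simp only [AffineMap.lineMap_apply_module]
    fun_prop
  filter_upwards [hcontract.continuousAt.eventually (isOpen_interior.mem_nhds hxt),
    hcontract.continuousAt.eventually (T.eventually_forall_mem_cell_imp _),
    T.eventually_forall_bary_pos p x] with z hz hzcell hzpos
  obtain ⟨L, hL, hzL⟩ := (mem_closure_iff (T := T)).1 (interior_subset hz)
  have hKL := bary_eq_bary hK hL hxtK (hzcell L hL hzL) p
  rw [(isFullSimplex hK).bary_lineMap_vertex hpK] at hKL
  have hpL : p ∈ L := mem_of_bary_pos (x := AffineMap.lineMap p x t) (by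
    rw [← hKL]
    nlinarith)
  rw [(isFullSimplex hL).bary_lineMap_vertex hpL] at hKL
  have hpxL : 0 < bary L p x := by
    have heq : t * (1 - bary K p x) = t * (1 - bary L p x) := by linarith
    linarith [mul_left_cancel₀ ht0.ne' heq]
  exact convexHull_subset_star hL hpL
    ((isFullSimplex hL).mem_convexHull_of_lineMap_mem hpL ht0 hzL (hzpos L hL hpxL).le)

theorem exists_vertex_notMem_interior (hK : K ∈ T.cells) {x : Eucl d} (hx : x ∈ Δ[K])
    (hxΩ : x ∉ interior (closure Ω)) : ∃ p ∈ K, p ∉ interior (closure Ω) := by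
  obtain ⟨p, hp, hpos⟩ : ∃ p ∈ K, 0 < T.hat p x :=
    Finset.exists_lt_of_sum_lt (by simp [sum_hat hK hx])
  refine ⟨p, hp, fun hpΩ => hxΩ (mem_interior_iff_mem_nhds.2 ?_)⟩
  exact Filter.mem_of_superset (star_mem_nhds hpΩ (convexHull_subset_closure hK hx) hpos)
    (star_subset_closure p)

/-- A segment from `y` can leave the star of `p` only where the hat function of `p` vanishes. -/
theorem mem_star_of_mul_dist_lt_hat {p y z : Eucl d} (hp : p ∈ interior (closure Ω))
    (hy : y ∈ closure Ω) {M : NNReal} (hM : ∀ K ∈ T.cells, LipschitzOnWith M (T.hat p) Δ[K])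
    (hyz : M * dist y z < T.hat p y) : z ∈ T.star p := by
  obtain ⟨K, hK, hyK⟩ := (mem_closure_iff (T := T)).1 hy
  have hpK : p ∈ K := by
    by_contra h
    rw [hat_of_notMem hK hyK h] at hyz
    exact hyz.not_ge (by positivity)
  obtain ⟨w, hw, hsub, hexit⟩ := exists_segment_subset_or_notMem_interior (isClosed_star p)
    (convexHull_subset_star hK hpK hyK) z
  have hwstar : w ∈ T.star p := hsub (right_mem_segment ℝ y w)
  rcases hexit with rfl | hexit
  · exact hwstar
  have hat_w : T.hat p w = 0 := by
    have hwΩ := star_subset_closure p hwstar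
    refine le_antisymm (not_lt.1 fun h => hexit ?_) (hat_nonneg hwΩ p)
    exact mem_interior_iff_mem_nhds.2 (star_mem_nhds hp hwΩ h)
  have hcover : segment ℝ y w ⊆ ⋃ K : T.cells, Δ[K.1] := fun v hv => by
    obtain ⟨L, hL, -, hvL⟩ := mem_star_iff.1 (hsub hv)
    exact Set.mem_iUnion.2 ⟨⟨L, hL⟩, hvL⟩
  have hdist := dist_le_mul_dist_of_segment_subset_iUnion
    (fun K : T.cells => K.1.finite_toSet.isClosed_convexHull ℝ) (fun K => hM K.1 K.2) hcover
  have hyw : dist y w ≤ dist y z := by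
    linarith [dist_add_dist_of_mem_segment hw, dist_nonneg (x := w) (y := z)]
  rw [hat_w, Real.dist_eq, sub_zero] at hdist
  have hle := mul_le_mul_of_nonneg_left hyw M.coe_nonneg
  linarith [le_abs_self (T.hat p y)]

end Triangulation

/-! ### Volume and mesh regularity -/

section Volume

variable {d : ℕ}

/-- The volume of the unit ball of `ℝ^d`, the unit in which the volumes of cells are measured. -/
def unitBallVolume (d : ℕ) : ℝ :=
  volume.real (ball (0 : Eucl d) 1)

variable (d) in
theorem unitBallVolume_pos : 0 < unitBallVolume d :=
  ENNReal.toReal_pos (measure_ball_pos _ _ one_pos).ne' measure_ball_lt_top.ne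

theorem volume_real_closedBall (x : Eucl d) {r : ℝ} (hr : 0 ≤ r) :
    volume.real (closedBall x r) = r ^ d * unitBallVolume d := by
  rw [Measure.addHaar_real_closedBall _ _ hr, finrank_euclideanSpace_fin, unitBallVolume]

theorem volume_real_ball (x : Eucl d) {r : ℝ} (hr : 0 ≤ r) [NeZero d] :
    volume.real (ball x r) = r ^ d * unitBallVolume d := by
  rw [← Measure.addHaar_real_closedBall_eq_addHaar_real_ball, volume_real_closedBall x hr]

theorem interior_convexHull_ae_eq (K : Finset (Eucl d)) :
    (interior Δ[K] : Set (Eucl d)) =ᵐ[volume] Δ[K] :=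
  interior_ae_eq_of_null_frontier ((convex_convexHull ℝ _).addHaar_frontier volume)

theorem volume_interior_convexHull_lt_top (K : Finset (Eucl d)) :
    volume (interior Δ[K]) < ⊤ :=
  ((isBounded_convexHull.2 K.finite_toSet.isBounded).subset interior_subset).measure_lt_top

end Volume

namespace Triangulation

variable {d : ℕ} {Ω : Set (Eucl d)} {T : Triangulation Ω} {K : Finset (Eucl d)}

theorem pairwiseDisjoint_interior {s : Finset (Finset (Eucl d))} (hs : s ⊆ T.cells) :
    (s : Set (Finset (Eucl d))).PairwiseDisjoint fun K => interior Δ[K] :=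
  fun _ hK _ hL hKL => disjoint_interior (hs hK) (hs hL) hKL

variable (T) in
theorem exists_mem_cells (hΩ : Ω.Nonempty) : ∃ K, K ∈ T.cells := by
  obtain ⟨x, hx⟩ := hΩ
  obtain ⟨K, hK, -⟩ := (mem_closure_iff (T := T)).1 (subset_closure hx)
  exact ⟨K, hK⟩

variable (T) in
/-- A mesh of size `h` and regularity `θ`: every cell has diameter at most `h` and contains a ball
of radius `θ h`. A shape regular and quasiuniform mesh has this property, which is all that the
estimates use. -/
structure IsRegularMesh (θ h : ℝ) : Prop where
  regularity_pos : 0 < θ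
  size_pos : 0 < h
  diam_le : ∀ K ∈ T.cells, diam Δ[K] ≤ h
  exists_closedBall : ∀ K ∈ T.cells, ∃ x, closedBall x (θ * h) ⊆ Δ[K]

theorem IsQuasiUniform.le_max_mul_diam {τ h : ℝ} (hτ : T.IsQuasiUniform τ h) (hK : K ∈ T.cells) :
    h ≤ max τ 1 * diam Δ[K] :=
  (hτ K hK).2.trans (mul_le_mul_of_nonneg_right (le_max_left _ _) diam_nonneg)

theorem isBounded (T : Triangulation Ω) : Bornology.IsBounded Ω :=
  ((Bornology.isBounded_biUnion_finset T.cells).2 fun K _ =>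
    isBounded_convexHull.2 K.finite_toSet.isBounded).subset fun _ hx =>
      Set.mem_iUnion₂.2 (by simpa using (mem_closure_iff (T := T)).1 (subset_closure hx))

theorem IsQuasiUniform.le_max_mul_diam_domain {τ h : ℝ} (hτ : T.IsQuasiUniform τ h)
    (hΩ : Ω.Nonempty) : h ≤ max τ 1 * diam Ω := by
  obtain ⟨K, hK⟩ := T.exists_mem_cells hΩ
  refine (hτ.le_max_mul_diam hK).trans (mul_le_mul_of_nonneg_left ?_ (by positivity))
  rw [← diam_closure Ω]
  exact diam_mono (convexHull_subset_closure hK) T.isBounded.closure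

theorem IsShapeRegular.isRegularMesh [NeZero d] (hΩ : Ω.Nonempty) {σ τ h : ℝ}
    (hσ : T.IsShapeRegular σ) (hτ : T.IsQuasiUniform τ h) :
    T.IsRegularMesh (max σ 1 * max τ 1)⁻¹ h where
  regularity_pos := by positivity
  size_pos := by
    obtain ⟨K, hK⟩ := T.exists_mem_cells hΩ
    exact (isFullSimplex hK).diam_pos.trans_le (hτ K hK).1
  diam_le K hK := (hτ K hK).1
  exists_closedBall K hK := by
    obtain ⟨x, ρ, hρ, hball, hdiam⟩ := hσ K hK
    refine ⟨x, (closedBall_subset_closedBall ?_).trans hball⟩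
    rw [inv_mul_le_iff₀ (by positivity)]
    calc h ≤ max τ 1 * diam Δ[K] := hτ.le_max_mul_diam hK
      _ ≤ max τ 1 * (max σ 1 * ρ) := by gcongr; exact hdiam.trans (by gcongr; exact le_max_left _ _)
      _ = max σ 1 * max τ 1 * ρ := by ring

namespace IsRegularMesh

variable {θ h : ℝ}

theorem radius_pos (hT : T.IsRegularMesh θ h) : 0 < θ * h :=
  mul_pos hT.regularity_pos hT.size_pos

theorem dist_le (hT : T.IsRegularMesh θ h) (hK : K ∈ T.cells) {x y : Eucl d} (hx : x ∈ Δ[K])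
    (hy : y ∈ Δ[K]) : dist x y ≤ h :=
  (dist_le_diam_of_mem (isBounded_convexHull.2 K.finite_toSet.isBounded) hx hy).trans
    (hT.diam_le K hK)

theorem lipschitzOnWith_hat (hT : T.IsRegularMesh θ h) (p : Eucl d) (hK : K ∈ T.cells) :
    LipschitzOnWith (θ * h)⁻¹.toNNReal (T.hat p) Δ[K] := by
  obtain ⟨c, hc⟩ := hT.exists_closedBall K hK
  intro x hx y hy
  rw [hat_eq_bary hK hx, hat_eq_bary hK hy]
  exact (isFullSimplex hK).lipschitzWith_bary hT.radius_pos hc p x y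

theorem ball_subset_star (hT : T.IsRegularMesh θ h) {p y : Eucl d} (hp : p ∈ interior (closure Ω))
    (hy : y ∈ closure Ω) {r : ℝ} (hr : r ≤ θ * h * T.hat p y) : ball y r ⊆ T.star p := by
  refine fun z hz => mem_star_of_mul_dist_lt_hat hp hy (fun K hK => hT.lipschitzOnWith_hat p hK) ?_
  rw [Real.coe_toNNReal _ (inv_nonneg.2 hT.radius_pos.le), inv_mul_lt_iff₀ hT.radius_pos, dist_comm]
  exact (mem_ball.1 hz).trans_le hr

theorem exists_closedBall_half_le_hat [NeZero d] (hT : T.IsRegularMesh θ h) (hK : K ∈ T.cells) :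
    ∃ c, closedBall c (θ * h / 2) ⊆ interior Δ[K] ∧
      ∀ z ∈ closedBall c (θ * h / 2), ∀ p ∈ K, θ / 2 ≤ T.hat p z := by
  have hr := hT.radius_pos
  obtain ⟨c, hc⟩ := hT.exists_closedBall K hK
  refine ⟨c, interior_maximal (ball_subset_closedBall.trans hc) isOpen_ball |>.trans' <|
    closedBall_subset_ball (half_lt_self hr), fun z hz p hp => ?_⟩
  have hzK : closedBall z (θ * h / 2) ⊆ Δ[K] :=
    (closedBall_subset_closedBall' (by linarith [mem_closedBall.1 hz])).trans hc
  have hz' := hzK (mem_closedBall_self (by positivity))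
  rw [hat_eq_bary hK hz']
  have hle := (isFullSimplex hK).le_diam_mul_bary (by positivity) hzK hp
  have hdiam := mul_le_mul_of_nonneg_right (hT.diam_le K hK) ((isFullSimplex hK).bary_nonneg hz' p)
  exact le_of_mul_le_mul_left (by linarith) hT.size_pos

theorem volume_interior_le (hT : T.IsRegularMesh θ h) (hK : K ∈ T.cells) :
    volume.real (interior Δ[K]) ≤ h ^ d * unitBallVolume d := by
  obtain ⟨c, hc⟩ := hT.exists_closedBall K hK
  have hcK := hc (mem_closedBall_self hT.radius_pos.le)
  rw [← volume_real_closedBall c hT.size_pos.le]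
  exact measureReal_mono (fun x hx => mem_closedBall.2 (hT.dist_le hK (interior_subset hx) hcK))
    measure_closedBall_lt_top.ne

theorem le_volume_interior [NeZero d] (hT : T.IsRegularMesh θ h) (hK : K ∈ T.cells) :
    (θ * h) ^ d * unitBallVolume d ≤ volume.real (interior Δ[K]) := by
  obtain ⟨c, hc⟩ := hT.exists_closedBall K hK
  rw [← volume_real_ball c hT.radius_pos.le]
  exact measureReal_mono (interior_maximal (ball_subset_closedBall.trans hc) isOpen_ball)
    (volume_interior_convexHull_lt_top K).ne

theorem card_le [NeZero d] (hT : T.IsRegularMesh θ h) {s : Finset (Finset (Eucl d))}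
    (hs : s ⊆ T.cells) {x : Eucl d} {R : ℝ} (hR : 0 ≤ R)
    (hsub : ∀ K ∈ s, Δ[K] ⊆ closedBall x (R * h)) : (s.card : ℝ) ≤ (R / θ) ^ d := by
  have hh := hT.size_pos
  have hvol : (s.card : ℝ) * ((θ * h) ^ d * unitBallVolume d) ≤ (R * h) ^ d * unitBallVolume d :=
    calc (s.card : ℝ) * ((θ * h) ^ d * unitBallVolume d)
        ≤ ∑ K ∈ s, volume.real (interior Δ[K]) := by
          rw [← nsmul_eq_mul]
          exact s.card_nsmul_le_sum _ _ fun K hK => hT.le_volume_interior (hs hK)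
      _ = volume.real (⋃ K ∈ s, interior Δ[K]) :=
          (measureReal_biUnion_finset (pairwiseDisjoint_interior hs)
            (fun _ _ => isOpen_interior.measurableSet)
            fun K _ => (volume_interior_convexHull_lt_top K).ne).symm
      _ ≤ volume.real (closedBall x (R * h)) :=
          measureReal_mono (Set.iUnion₂_subset fun K hK => interior_subset.trans (hsub K hK))
            measure_closedBall_lt_top.ne
      _ = (R * h) ^ d * unitBallVolume d := volume_real_closedBall x (by positivity)
  rw [← mul_assoc] at hvol
  have hcard := le_of_mul_le_mul_right hvol (unitBallVolume_pos d)
  rwa [← le_div_iff₀ (pow_pos hT.radius_pos d), ← div_pow, mul_div_mul_right _ _ hh.ne'] at hcard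

end IsRegularMesh

end Triangulation

namespace Triangulation

variable {d : ℕ} {Ω Ωk : Set (Eucl d)} {T : Triangulation Ω} {δ : ℝ} {K : Finset (Eucl d)}

theorem mem_subCells :
    K ∈ T.subCells Ωk δ ↔ K ∈ T.cells ∧ ∃ x ∈ Δ[K], infDist x Ωk ≤ δ := by
  classical
  exact Finset.mem_filter

theorem subCells_subset : T.subCells Ωk δ ⊆ T.cells := fun _ h => (mem_subCells.1 h).1

theorem mem_subCells_of_inter_nonempty (hK : K ∈ T.cells) (hδ : 0 ≤ δ)
    (h : (Δ[K] ∩ Ωk).Nonempty) : K ∈ T.subCells Ωk δ := by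
  obtain ⟨x, hxK, hx⟩ := h
  exact mem_subCells.2 ⟨hK, x, hxK, by rwa [infDist_zero_of_mem hx]⟩

theorem interior_subset_extDomain (hK : K ∈ T.subCells Ωk δ) : interior Δ[K] ⊆ T.extDomain Ωk δ :=
  interior_mono (Set.subset_iUnion₂_of_subset K hK subset_rfl)

theorem exists_cell_of_mem_extDomain {x : Eucl d} (hx : x ∈ T.extDomain Ωk δ) :
    ∃ K ∈ T.subCells Ωk δ, x ∈ Δ[K] := by
  simpa using interior_subset hx

theorem extDomain_subset_closure : T.extDomain Ωk δ ⊆ closure Ω := fun _ hx => by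
  obtain ⟨K, hK, hxK⟩ := exists_cell_of_mem_extDomain hx
  exact convexHull_subset_closure (subCells_subset hK) hxK

theorem subset_extDomain (hΩk : IsOpen Ωk) (hsub : Ωk ⊆ Ω) (hδ : 0 ≤ δ) :
    Ωk ⊆ T.extDomain Ωk δ := by
  refine interior_maximal (fun x hx => ?_) hΩk
  obtain ⟨K, hK, hxK⟩ := (mem_closure_iff (T := T)).1 (subset_closure (hsub hx))
  exact Set.mem_iUnion₂.2 ⟨K, mem_subCells_of_inter_nonempty hK hδ ⟨x, hxK, hx⟩, hxK⟩

theorem measurableSet_extDomain : MeasurableSet (T.extDomain Ωk δ) :=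
  isOpen_interior.measurableSet

instance isFiniteMeasure_restrict_extDomain :
    IsFiniteMeasure (volume.restrict (T.extDomain Ωk δ)) := by
  refine isFiniteMeasure_restrict.2
    ((Bornology.IsBounded.subset ?_ interior_subset).measure_lt_top).ne
  exact (Bornology.isBounded_biUnion_finset _).2 fun K _ =>
    isBounded_convexHull.2 K.finite_toSet.isBounded

theorem extDomain_ae_eq :
    (T.extDomain Ωk δ : Set (Eucl d)) =ᵐ[volume] ⋃ K ∈ T.subCells Ωk δ, interior Δ[K] := by
  have hclosed : (⋃ K ∈ T.subCells Ωk δ, interior Δ[K] : Set (Eucl d)) =ᵐ[volume]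
      ⋃ K ∈ T.subCells Ωk δ, Δ[K] :=
    Filter.EventuallyEq.countable_bUnion (T.subCells Ωk δ).countable_toSet
      fun K _ => interior_convexHull_ae_eq K
  exact ((LE.le.eventuallyLE interior_subset).trans hclosed.symm.le).antisymm
    (LE.le.eventuallyLE (Set.iUnion₂_subset fun K hK => interior_subset_extDomain hK))

theorem setIntegral_extDomain {f : Eucl d → ℝ} (hf : IntegrableOn f (T.extDomain Ωk δ)) :
    ∫ x in T.extDomain Ωk δ, f x = ∑ K ∈ T.subCells Ωk δ, ∫ x in interior Δ[K], f x := by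
  rw [setIntegral_congr_set extDomain_ae_eq]
  exact integral_biUnion_finset _ (fun _ _ => isOpen_interior.measurableSet)
    (pairwiseDisjoint_interior subCells_subset)
    (fun K hK => hf.mono_set (interior_subset_extDomain hK))

end Triangulation

/-! ### Nodal values and the stabilization form -/

namespace Triangulation

variable {d : ℕ} {Ω Ωk : Set (Eucl d)} {T : Triangulation Ω} {δ : ℝ} {K : Finset (Eucl d)}
  {G : Eucl d → Eucl d}

theorem continuousOn_hat (p : Eucl d) : ContinuousOn (T.hat p) (closure Ω) := by
  have hcont : ContinuousOn (T.hat p) (⋃ K : T.cells, Δ[K.1]) :=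
    (locallyFinite_of_finite _).continuousOn_iUnion
      (fun K => K.1.finite_toSet.isClosed_convexHull ℝ)
      fun K => (continuous_bary K.1 p).continuousOn.congr fun x hx => hat_eq_bary K.2 hx p
  refine hcont.mono fun x hx => ?_
  obtain ⟨K, hK, hxK⟩ := (mem_closure_iff (T := T)).1 hx
  exact Set.mem_iUnion.2 ⟨⟨K, hK⟩, hxK⟩

theorem integrableOn_hat_smul {F : Type*} [NormedAddCommGroup F] [NormedSpace ℝ F] {f : Eucl d → F}
    (hf : IntegrableOn f (T.extDomain Ωk δ)) (p : Eucl d) :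
    IntegrableOn (fun x => T.hat p x • f x) (T.extDomain Ωk δ) := by
  refine Integrable.bdd_smul hf 1 (((continuousOn_hat p).mono
    extDomain_subset_closure).aestronglyMeasurable measurableSet_extDomain) ?_
  filter_upwards [ae_restrict_mem measurableSet_extDomain] with x hx
  have hx' := extDomain_subset_closure hx
  rw [Real.norm_of_nonneg (hat_nonneg hx' p)]
  exact hat_le_one hx' p

variable (T Ωk δ) in
open Classical in
/-- All vertices of the sub-triangulation, including those on `∂Ω`, which are not nodes. -/
def vertices : Finset (Eucl d) :=
  (T.subCells Ωk δ).biUnion id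

theorem subset_vertices (hK : K ∈ T.subCells Ωk δ) : K ⊆ T.vertices Ωk δ := by
  classical
  exact Finset.subset_biUnion_of_mem id hK

theorem sum_vertices_hat_smul {F : Type*} [AddCommGroup F] [Module ℝ F]
    (hK : K ∈ T.subCells Ωk δ) {x : Eucl d} (hx : x ∈ Δ[K]) (f : Eucl d → F) :
    ∑ p ∈ T.vertices Ωk δ, T.hat p x • f p = ∑ p ∈ K, T.hat p x • f p := by
  refine (Finset.sum_subset (subset_vertices hK) fun p _ hp => ?_).symm
  rw [hat_of_notMem (subCells_subset hK) hx hp, zero_smul]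

variable (T Ωk δ) in
open Classical in
/-- The nodal values of the lumped projection of `G`: its coefficients at the nodes, and zero at the
vertices on `∂Ω`. -/
def nodeVal (G : Eucl d → Eucl d) (p : Eucl d) : Eucl d :=
  if p ∈ T.nodes Ωk δ then T.coeff Ωk δ G p else 0

theorem nodeVal_of_mem_frontier (G : Eucl d → Eucl d) {p : Eucl d} (hp : p ∈ frontier Ω) :
    T.nodeVal Ωk δ G p = 0 := by
  classical
  refine if_neg fun h => ?_
  rw [nodes, Finset.mem_filter] at h
  exact h.2 hp

theorem proj_eq_sum_vertices (G : Eucl d → Eucl d) (x : Eucl d) :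
    T.proj Ωk δ G x = ∑ p ∈ T.vertices Ωk δ, T.hat p x • T.nodeVal Ωk δ G p := by
  classical
  have hsub : T.nodes Ωk δ ⊆ T.vertices Ωk δ := Finset.filter_subset _ _
  rw [proj, ← Finset.sum_subset hsub]
  · exact Finset.sum_congr rfl fun p hp => by rw [nodeVal, if_pos hp]
  · intro p _ hp
    rw [nodeVal, if_neg hp, smul_zero]

variable (T Ωk δ) in
/-- The density of the stabilization form: the weighted squared deviations of `G` from the nodal
values of its lumped projection. -/
def energy (G : Eucl d → Eucl d) (x : Eucl d) : ℝ :=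
  ∑ p ∈ T.vertices Ωk δ, T.hat p x * ‖G x - T.nodeVal Ωk δ G p‖ ^ 2

theorem energy_nonneg (G : Eucl d → Eucl d) {x : Eucl d} (hx : x ∈ closure Ω) :
    0 ≤ T.energy Ωk δ G x :=
  Finset.sum_nonneg fun p _ => mul_nonneg (hat_nonneg hx p) (by positivity)

theorem energy_eq_sum_cell (G : Eucl d → Eucl d) (hK : K ∈ T.subCells Ωk δ) {x : Eucl d}
    (hx : x ∈ Δ[K]) :
    T.energy Ωk δ G x = ∑ p ∈ K, T.hat p x * ‖G x - T.nodeVal Ωk δ G p‖ ^ 2 :=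
  sum_vertices_hat_smul hK hx fun p => ‖G x - T.nodeVal Ωk δ G p‖ ^ 2

theorem inner_sub_proj_eq (G : Eucl d → Eucl d) {x : Eucl d} (hx : x ∈ T.extDomain Ωk δ) :
    ⟪G x - T.proj Ωk δ G x, G x⟫ = T.energy Ωk δ G x +
      ∑ p ∈ T.vertices Ωk δ, T.hat p x * ⟪T.nodeVal Ωk δ G p, G x - T.nodeVal Ωk δ G p⟫ := by
  obtain ⟨K, hK, hxK⟩ := exists_cell_of_mem_extDomain hx
  have hG : G x = ∑ p ∈ T.vertices Ωk δ, T.hat p x • G x := by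
    rw [sum_vertices_hat_smul hK hxK fun _ => G x, ← Finset.sum_smul,
      sum_hat (subCells_subset hK) hxK, one_smul]
  calc ⟪G x - T.proj Ωk δ G x, G x⟫
      = ⟪∑ p ∈ T.vertices Ωk δ, T.hat p x • (G x - T.nodeVal Ωk δ G p), G x⟫ := by
        simp only [smul_sub, Finset.sum_sub_distrib, ← hG, ← proj_eq_sum_vertices]
    _ = ∑ p ∈ T.vertices Ωk δ, T.hat p x * ⟪G x - T.nodeVal Ωk δ G p, G x⟫ := by
        simp only [sum_inner, real_inner_smul_left]
    _ = _ := by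
        rw [energy, ← Finset.sum_add_distrib]
        refine Finset.sum_congr rfl fun p _ => ?_
        rw [← mul_add, ← real_inner_self_eq_norm_sq, real_inner_comm (G x - _) (T.nodeVal Ωk δ G p),
          ← inner_add_right, sub_add_cancel]

theorem integrableOn_of_memLp (hG : MemLp G 2 (volume.restrict (T.extDomain Ωk δ))) :
    IntegrableOn G (T.extDomain Ωk δ) :=
  hG.integrable one_le_two

theorem integrableOn_norm_sub_sq (hG : MemLp G 2 (volume.restrict (T.extDomain Ωk δ)))
    (c : Eucl d) : IntegrableOn (fun x => ‖G x - c‖ ^ 2) (T.extDomain Ωk δ) :=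
  (hG.sub (memLp_const c)).integrable_norm_pow two_ne_zero

theorem integrableOn_norm_sq (hG : MemLp G 2 (volume.restrict (T.extDomain Ωk δ))) :
    IntegrableOn (fun x => ‖G x‖ ^ 2) (T.extDomain Ωk δ) :=
  hG.integrable_norm_pow two_ne_zero

theorem integrableOn_energy (hG : MemLp G 2 (volume.restrict (T.extDomain Ωk δ))) :
    IntegrableOn (T.energy Ωk δ G) (T.extDomain Ωk δ) :=
  integrable_finsetSum _ fun p _ => integrableOn_hat_smul (integrableOn_norm_sub_sq hG _) p

/-- The nodal value at a node `p` is the average of `G` with weight `hat p`. -/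
theorem integral_hat_mul_inner_nodeVal (hG : IntegrableOn G (T.extDomain Ωk δ)) (p : Eucl d) :
    ∫ x in T.extDomain Ωk δ,
      T.hat p x * ⟪T.nodeVal Ωk δ G p, G x - T.nodeVal Ωk δ G p⟫ = 0 := by
  classical
  by_cases hp : p ∉ T.nodes Ωk δ
  · simp [nodeVal, hp]
  set g := T.nodeVal Ωk δ G p
  have hg : g = (∫ x in T.extDomain Ωk δ, T.hat p x)⁻¹ • ∫ x in T.extDomain Ωk δ, T.hat p x • G x :=
    if_pos (not_not.1 hp)
  have hg_int : IntegrableOn (fun _ => g) (T.extDomain Ωk δ) := integrable_const g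
  have hdiff : IntegrableOn (fun x => T.hat p x • G x - T.hat p x • g) (T.extDomain Ωk δ) :=
    (integrableOn_hat_smul hG p).sub (integrableOn_hat_smul hg_int p)
  have hsub : ∫ x in T.extDomain Ωk δ, T.hat p x * ⟪g, G x - g⟫ =
      ⟪g, (∫ x in T.extDomain Ωk δ, T.hat p x • G x) -
        (∫ x in T.extDomain Ωk δ, T.hat p x) • g⟫ := by
    rw [← integral_smul_const, ← integral_sub (integrableOn_hat_smul hG p)
      (integrableOn_hat_smul hg_int p), ← integral_inner hdiff]
    simp only [← smul_sub, real_inner_smul_right]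
  rw [hsub]
  rcases eq_or_ne (∫ x in T.extDomain Ωk δ, T.hat p x) 0 with hm | hm
  · simp [hg, hm]
  · rw [hg, smul_inv_smul₀ hm, sub_self, inner_zero_right]

theorem stab_eq_integral_energy (hG : MemLp G 2 (volume.restrict (T.extDomain Ωk δ))) :
    T.stab Ωk δ G G = ∫ x in T.extDomain Ωk δ, T.energy Ωk δ G x := by
  have hG₁ := integrableOn_of_memLp hG
  have hdev (g : Eucl d) : IntegrableOn (fun x => ⟪g, G x - g⟫) (T.extDomain Ωk δ) :=
    (hG₁.sub (integrable_const g)).const_inner g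
  have hint : ∀ p ∈ T.vertices Ωk δ, IntegrableOn
      (fun x => T.hat p x * ⟪T.nodeVal Ωk δ G p, G x - T.nodeVal Ωk δ G p⟫) (T.extDomain Ωk δ) :=
    fun p _ => integrableOn_hat_smul (hdev _) p
  rw [stab, setIntegral_congr_fun measurableSet_extDomain fun x hx => inner_sub_proj_eq G hx,
    integral_add (integrableOn_energy hG) (integrable_finsetSum _ hint), integral_finsetSum _ hint,
    Finset.sum_eq_zero fun p _ => integral_hat_mul_inner_nodeVal hG₁ p, add_zero]

end Triangulation

/-! ### Estimates on a cell -/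

theorem norm_sq_le_two_mul_norm_sub_sq_add {E : Type*} [SeminormedAddCommGroup E] (a b : E) :
    ‖a‖ ^ 2 ≤ 2 * ‖a - b‖ ^ 2 + 2 * ‖b‖ ^ 2 := by
  rw [← mul_add]
  refine (pow_le_pow_left₀ (norm_nonneg a) ?_ 2).trans add_sq_le
  simpa using norm_add_le (a - b) b

namespace Triangulation

variable {d : ℕ} {Ω Ωk : Set (Eucl d)} {T : Triangulation Ω} {δ θ h : ℝ} {K : Finset (Eucl d)}
  {G : Eucl d → Eucl d}

theorem le_two_mul_energy_add (hK : K ∈ T.subCells Ωk δ) {x : Eucl d} (hx : x ∈ Δ[K]) {a b : ℝ}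
    (hab : ∀ p ∈ K, a ≤ 2 * ‖G x - T.nodeVal Ωk δ G p‖ ^ 2 + b) :
    a ≤ 2 * T.energy Ωk δ G x + b := by
  have hKc := subCells_subset hK
  have hx' := convexHull_subset_closure hKc hx
  calc a = ∑ p ∈ K, T.hat p x * a := by rw [← Finset.sum_mul, sum_hat hKc hx, one_mul]
    _ ≤ ∑ p ∈ K, T.hat p x * (2 * ‖G x - T.nodeVal Ωk δ G p‖ ^ 2 + b) :=
        Finset.sum_le_sum fun p hp => mul_le_mul_of_nonneg_left (hab p hp) (hat_nonneg hx' p)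
    _ = 2 * T.energy Ωk δ G x + b := by
        simp only [mul_add, mul_left_comm _ (2 : ℝ), Finset.sum_add_distrib, ← Finset.mul_sum,
          ← Finset.sum_mul, sum_hat hKc hx, one_mul, energy_eq_sum_cell G hK hx]

theorem hat_mul_norm_sub_sq_le_energy (hK : K ∈ T.subCells Ωk δ) {x : Eucl d} (hx : x ∈ Δ[K])
    {p : Eucl d} (hp : p ∈ K) :
    T.hat p x * ‖G x - T.nodeVal Ωk δ G p‖ ^ 2 ≤ T.energy Ωk δ G x := by
  rw [energy_eq_sum_cell G hK hx]
  have hx' := convexHull_subset_closure (subCells_subset hK) hx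
  exact Finset.single_le_sum (f := fun p => T.hat p x * ‖G x - T.nodeVal Ωk δ G p‖ ^ 2)
    (fun q _ => mul_nonneg (hat_nonneg hx' q) (sq_nonneg _)) hp

theorem mul_norm_nodeVal_sub_sq_le_energy (hK : K ∈ T.subCells Ωk δ) {x : Eucl d} (hx : x ∈ Δ[K])
    {w : ℝ} (hw : ∀ p ∈ K, w ≤ T.hat p x) {p q : Eucl d} (hp : p ∈ K) (hq : q ∈ K) :
    w / 4 * ‖T.nodeVal Ωk δ G p - T.nodeVal Ωk δ G q‖ ^ 2 ≤ T.energy Ωk δ G x := by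
  rcases le_or_gt w 0 with hw₀ | hw₀
  · exact (mul_nonpos_of_nonpos_of_nonneg (by linarith) (sq_nonneg _)).trans
      (energy_nonneg G (convexHull_subset_closure (subCells_subset hK) hx))
  have hvertex (r : Eucl d) (hr : r ∈ K) :
      w * ‖G x - T.nodeVal Ωk δ G r‖ ^ 2 ≤ T.energy Ωk δ G x :=
    (mul_le_mul_of_nonneg_right (hw r hr) (sq_nonneg _)).trans
      (hat_mul_norm_sub_sq_le_energy hK hx hr)
  have hsplit := norm_sq_le_two_mul_norm_sub_sq_add
    (T.nodeVal Ωk δ G p - T.nodeVal Ωk δ G q) (G x - T.nodeVal Ωk δ G q)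
  rw [sub_sub_sub_cancel_right, norm_sub_rev _ (G x)] at hsplit
  linarith [mul_le_mul_of_nonneg_left hsplit hw₀.le, hvertex p hp, hvertex q hq]

theorem integrableOn_interior_cell {f : Eucl d → ℝ} (hf : IntegrableOn f (T.extDomain Ωk δ))
    (hK : K ∈ T.subCells Ωk δ) : IntegrableOn f (interior Δ[K]) :=
  hf.mono_set (interior_subset_extDomain hK)

theorem setIntegral_energy_nonneg (G : Eucl d → Eucl d) (hK : K ∈ T.subCells Ωk δ) :
    0 ≤ ∫ x in interior Δ[K], T.energy Ωk δ G x :=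
  setIntegral_nonneg isOpen_interior.measurableSet fun _ hx => energy_nonneg G
    (convexHull_subset_closure (subCells_subset hK) (interior_subset hx))

theorem setIntegral_energy_le_interior_cell
    (hG : MemLp G 2 (volume.restrict (T.extDomain Ωk δ))) (hK : K ∈ T.subCells Ωk δ)
    {S : Set (Eucl d)} (hS : S ⊆ interior Δ[K]) :
    ∫ x in S, T.energy Ωk δ G x ≤ ∫ x in interior Δ[K], T.energy Ωk δ G x := by
  refine setIntegral_mono_set (integrableOn_interior_cell (integrableOn_energy hG) hK) ?_
    (LE.le.eventuallyLE hS)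
  filter_upwards [ae_restrict_mem isOpen_interior.measurableSet] with x hx
  exact energy_nonneg G (convexHull_subset_closure (subCells_subset hK) (interior_subset hx))

theorem norm_nodeVal_sub_sq_le [NeZero d] (hT : T.IsRegularMesh θ h)
    (hG : MemLp G 2 (volume.restrict (T.extDomain Ωk δ))) (hK : K ∈ T.subCells Ωk δ)
    {p q : Eucl d} (hp : p ∈ K) (hq : q ∈ K) :
    h ^ d * unitBallVolume d * ‖T.nodeVal Ωk δ G p - T.nodeVal Ωk δ G q‖ ^ 2 ≤
      8 / θ * (2 / θ) ^ d * ∫ x in interior Δ[K], T.energy Ωk δ G x := by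
  have hθ := hT.regularity_pos
  have hh := hT.size_pos
  set s := ‖T.nodeVal Ωk δ G p - T.nodeVal Ωk δ G q‖ ^ 2
  obtain ⟨c, hc, hhat⟩ := hT.exists_closedBall_half_le_hat (subCells_subset hK)
  have hball : θ / 8 * s * ((θ * h / 2) ^ d * unitBallVolume d) ≤
      ∫ x in interior Δ[K], T.energy Ωk δ G x := by
    rw [← volume_real_closedBall c (by positivity)]
    refine (setIntegral_ge_of_const_le_real measurableSet_closedBall
      measure_closedBall_lt_top.ne (fun z hz => ?_) ?_).trans
      (setIntegral_energy_le_interior_cell hG hK hc)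
    · have := mul_norm_nodeVal_sub_sq_le_energy (G := G) hK (interior_subset (hc hz)) (hhat z hz)
        hp hq
      rwa [div_div, show (2 : ℝ) * 4 = 8 by norm_num] at this
    · exact (integrableOn_interior_cell (integrableOn_energy hG) hK).mono_set hc
  calc h ^ d * unitBallVolume d * s
      = 8 / θ * (2 / θ) ^ d * (θ / 8 * s * ((θ * h / 2) ^ d * unitBallVolume d)) := by
        rw [mul_div_assoc, mul_pow, div_pow, div_pow]
        field_simp
    _ ≤ _ := by gcongr

theorem exists_norm_nodeVal_sq_le (hG : MemLp G 2 (volume.restrict (T.extDomain Ωk δ)))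
    (hΩk : IsOpen Ωk) (hK : K ∈ T.subCells Ωk δ) :
    ∃ q ∈ K, volume.real (interior Δ[K] ∩ Ωk) * ‖T.nodeVal Ωk δ G q‖ ^ 2 ≤
      2 * ((∫ x in interior Δ[K], T.energy Ωk δ G x) +
        ∫ x in interior Δ[K] ∩ Ωk, ‖G x‖ ^ 2) := by
  obtain ⟨q, hq, hmin⟩ := K.exists_min_image (fun q => ‖T.nodeVal Ωk δ G q‖ ^ 2)
    (nonempty_of_mem_cells (subCells_subset hK))
  refine ⟨q, hq, ?_⟩
  have hsub : interior Δ[K] ∩ Ωk ⊆ interior Δ[K] := Set.inter_subset_left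
  have henergy := (integrableOn_interior_cell (integrableOn_energy hG) hK).mono_set hsub
  have hnorm := (integrableOn_interior_cell (integrableOn_norm_sq hG) hK).mono_set hsub
  have hpt : ∀ x ∈ interior Δ[K] ∩ Ωk,
      ‖T.nodeVal Ωk δ G q‖ ^ 2 ≤ 2 * T.energy Ωk δ G x + 2 * ‖G x‖ ^ 2 := fun x hx => by
    refine le_two_mul_energy_add hK (interior_subset hx.1) fun p hp => (hmin p hp).trans ?_
    rw [norm_sub_rev]
    exact norm_sq_le_two_mul_norm_sub_sq_add _ _
  have hint := setIntegral_ge_of_const_le_real (isOpen_interior.inter hΩk).measurableSet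
    ((measure_mono hsub).trans_lt (volume_interior_convexHull_lt_top K)).ne hpt
    ((henergy.const_mul 2).add (hnorm.const_mul 2))
  rw [integral_add (henergy.const_mul 2) (hnorm.const_mul 2), integral_const_mul,
    integral_const_mul, mul_comm] at hint
  linarith [setIntegral_energy_le_interior_cell hG hK hsub]

theorem setIntegral_norm_sq_le (hT : T.IsRegularMesh θ h)
    (hG : MemLp G 2 (volume.restrict (T.extDomain Ωk δ))) (hK : K ∈ T.subCells Ωk δ)
    {B : ℝ} (hB : ∀ p ∈ K, ‖T.nodeVal Ωk δ G p‖ ^ 2 ≤ B) :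
    ∫ x in interior Δ[K], ‖G x‖ ^ 2 ≤
      2 * (∫ x in interior Δ[K], T.energy Ωk δ G x) + 2 * (h ^ d * unitBallVolume d * B) := by
  have henergy := integrableOn_interior_cell (integrableOn_energy hG) hK
  have hnorm := integrableOn_interior_cell (integrableOn_norm_sq hG) hK
  have hconst : IntegrableOn (fun _ => 2 * B) (interior Δ[K]) :=
    integrableOn_const (volume_interior_convexHull_lt_top K).ne
  obtain ⟨q, hq⟩ := nonempty_of_mem_cells (subCells_subset hK)
  have hB₀ : 0 ≤ B := (sq_nonneg _).trans (hB q hq)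
  have hpt : ∀ x ∈ interior Δ[K], ‖G x‖ ^ 2 ≤ 2 * T.energy Ωk δ G x + 2 * B := fun x hx =>
    le_two_mul_energy_add hK (interior_subset hx) fun p hp =>
      (norm_sq_le_two_mul_norm_sub_sq_add _ (T.nodeVal Ωk δ G p)).trans (by linarith [hB p hp])
  calc ∫ x in interior Δ[K], ‖G x‖ ^ 2
      ≤ ∫ x in interior Δ[K], (2 * T.energy Ωk δ G x + 2 * B) :=
        setIntegral_mono_on hnorm ((henergy.const_mul 2).add hconst) isOpen_interior.measurableSet
          hpt
    _ = 2 * (∫ x in interior Δ[K], T.energy Ωk δ G x) + 2 * (volume.real (interior Δ[K]) * B) := by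
        rw [integral_add (henergy.const_mul 2) hconst, integral_const_mul, setIntegral_const,
          smul_eq_mul, mul_left_comm]
    _ ≤ _ := by gcongr; exact hT.volume_interior_le (subCells_subset hK)

end Triangulation

/-! ### Chains of cells -/

namespace Triangulation

variable {d : ℕ} {Ω Ωk : Set (Eucl d)} {T : Triangulation Ω} {δ θ h C η : ℝ}
  {K L : Finset (Eucl d)}

theorem exists_segment_subset_closure (hne : Ωk.Nonempty) (hK : K ∈ T.subCells Ωk δ) :
    ∃ x ∈ Δ[K], ∃ z, segment ℝ x z ⊆ closure Ω ∧
      (∀ w ∈ segment ℝ x z, infDist w Ωk ≤ δ ∧ dist x w ≤ δ) ∧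
      (z ∈ closure Ωk ∨ z ∉ interior (closure Ω)) := by
  obtain ⟨hKc, x, hxK, hxδ⟩ := mem_subCells.1 hK
  obtain ⟨y, hy, hxy⟩ := exists_mem_closure_infDist_eq_dist hne x
  rw [hxy] at hxδ
  obtain ⟨z, hz, hzΩ, hend⟩ := exists_segment_subset_or_notMem_interior
    (isClosed_closure (s := Ω)) (convexHull_subset_closure hKc hxK) y
  refine ⟨x, hxK, z, hzΩ, fun w hw => ?_, hend.imp_left (by rintro rfl; exact hy)⟩
  have hw' : w ∈ segment ℝ x y := (convex_segment x y).segment_subset (left_mem_segment ℝ x y) hz hw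
  have hadd := dist_add_dist_of_mem_segment hw'
  refine ⟨?_, by linarith [dist_nonneg (x := w) (y := y)]⟩
  rw [← infDist_closure]
  linarith [infDist_le_dist_of_mem (x := w) hy, dist_nonneg (x := x) (y := w)]

open Classical in
variable (T Ωk δ) in
/-- The cells of the sub-triangulation at distance at most `δ + h` from `K`: they include the
cells that meet a segment of length at most `δ` starting in `K`, and the cells of the
sub-triangulation that share a vertex with one of these. -/
def neighbors (h : ℝ) (K : Finset (Eucl d)) : Finset (Finset (Eucl d)) :=
  {L ∈ T.subCells Ωk δ | ∃ a ∈ Δ[K], ∃ b ∈ Δ[L], dist a b ≤ δ + h}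

theorem mem_neighbors : L ∈ T.neighbors Ωk δ h K ↔
    L ∈ T.subCells Ωk δ ∧ ∃ a ∈ Δ[K], ∃ b ∈ Δ[L], dist a b ≤ δ + h := by
  classical
  exact Finset.mem_filter

theorem neighbors_subset : T.neighbors Ωk δ h K ⊆ T.subCells Ωk δ := fun _ hL =>
  (mem_neighbors.1 hL).1

theorem mem_neighbors_symm (hK : K ∈ T.subCells Ωk δ) (hL : L ∈ T.neighbors Ωk δ h K) :
    K ∈ T.neighbors Ωk δ h L := by
  obtain ⟨-, a, ha, b, hb, hab⟩ := mem_neighbors.1 hL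
  exact mem_neighbors.2 ⟨hK, b, hb, a, ha, by rwa [dist_comm]⟩

theorem mem_neighbors_self (hδ : 0 ≤ δ) (hh : 0 ≤ h) (hK : K ∈ T.subCells Ωk δ) :
    K ∈ T.neighbors Ωk δ h K := by
  obtain ⟨x, hx⟩ :=
    (convexHull_nonempty_iff (𝕜 := ℝ)).2 (nonempty_of_mem_cells (subCells_subset hK)).to_set
  exact mem_neighbors.2 ⟨hK, x, hx, x, hx, by rw [dist_self]; positivity⟩

/-- A bound for the number of neighbours of a cell of a mesh of regularity `θ`, for `δ ≤ C h`. -/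
def overlapBound (d : ℕ) (θ C : ℝ) : ℝ :=
  ((C + 3) / θ) ^ d

theorem IsRegularMesh.card_neighbors_le [NeZero d] (hT : T.IsRegularMesh θ h) (hδ : 0 ≤ δ)
    (hδC : δ ≤ C * h) (hK : K ∈ T.cells) :
    ((T.neighbors Ωk δ h K).card : ℝ) ≤ overlapBound d θ C := by
  have hC : 0 ≤ C := nonneg_of_mul_nonneg_left (hδ.trans hδC) hT.size_pos
  obtain ⟨x, hx⟩ := (convexHull_nonempty_iff (𝕜 := ℝ)).2 (nonempty_of_mem_cells hK).to_set
  refine hT.card_le (x := x) (neighbors_subset.trans subCells_subset) (by positivity)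
    fun L hL z hz => mem_closedBall.2 ?_
  obtain ⟨hLs, a, ha, b, hb, hab⟩ := mem_neighbors.1 hL
  have hzb := hT.dist_le (subCells_subset hLs) hz hb
  have hax := hT.dist_le hK ha hx
  have htri := dist_triangle4 z b a x
  rw [dist_comm b a] at htri
  linarith

theorem dist_le_overlapBound_mul [NeZero d] {M : Type*} [PseudoMetricSpace M]
    (hT : T.IsRegularMesh θ h) (hδ : 0 ≤ δ) (hδC : δ ≤ C * h) (hK : K ∈ T.subCells Ωk δ)
    {g : Eucl d → M} {D : ℝ}
    (hD : ∀ L ∈ T.neighbors Ωk δ h K, ∀ p ∈ L, ∀ q ∈ L, dist (g p) (g q) ≤ D)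
    {x z : Eucl d} (hx : x ∈ Δ[K]) (hxz : segment ℝ x z ⊆ closure Ω)
    (hseg : ∀ w ∈ segment ℝ x z, infDist w Ωk ≤ δ ∧ dist x w ≤ δ) (hL : L ∈ T.cells)
    (hz : z ∈ Δ[L]) {q p : Eucl d} (hq : q ∈ K) (hp : p ∈ L) :
    dist (g q) (g p) ≤ overlapBound d θ C * D := by
  classical
  let s := {L ∈ T.subCells Ωk δ | (segment ℝ x z ∩ Δ[L]).Nonempty}
  have mem_s {L : Finset (Eucl d)} {w : Eucl d} (hL : L ∈ T.cells) (hw : w ∈ segment ℝ x z)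
      (hwL : w ∈ Δ[L]) : L ∈ s :=
    Finset.mem_filter.2 ⟨mem_subCells.2 ⟨hL, w, hwL, (hseg w hw).1⟩, w, hw, hwL⟩
  have hs : s ⊆ T.neighbors Ωk δ h K := fun L hL => by
    obtain ⟨hLs, w, hw, hwL⟩ := Finset.mem_filter.1 hL
    exact mem_neighbors.2 ⟨hLs, x, hx, w, hwL, by linarith [(hseg w hw).2, hT.size_pos]⟩
  have hsc : s ⊆ T.cells := (Finset.filter_subset _ _).trans subCells_subset
  have hKs : K ∈ s := mem_s (subCells_subset hK) (left_mem_segment ℝ x z) hx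
  have hLs : L ∈ s := mem_s hL (right_mem_segment ℝ x z) hz
  have hchain : dist (g q) (g p) ≤ Fintype.card s * D := by
    refine dist_le_card_mul_of_isPreconnected (ι := s) (convex_segment x z).isPreconnected
      (F := fun L => Δ[L.1]) (V := fun L => g '' (L.1 : Set (Eucl d)))
      (i := ⟨K, hKs⟩) (j := ⟨L, hLs⟩) (fun L => L.1.finite_toSet.isClosed_convexHull ℝ)
      (fun w hw => ?_) (fun L => (Finset.mem_filter.1 L.2).2) ?_ (fun L L' hLL' => ?_)
      ⟨q, hq, rfl⟩ ⟨p, hp, rfl⟩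
    · obtain ⟨L, hL, hwL⟩ := (mem_closure_iff (T := T)).1 (hxz hw)
      exact Set.mem_iUnion.2 ⟨⟨L, mem_s hL hw hwL⟩, hwL⟩
    · rintro L _ ⟨u, hu, rfl⟩ _ ⟨v, hv, rfl⟩
      exact hD L (hs L.2) u hu v hv
    · obtain ⟨v, hvL, hvL'⟩ := exists_mem_inter (hsc L.2) (hsc L'.2) hLL'
      exact ⟨g v, ⟨v, hvL, rfl⟩, v, hvL', rfl⟩
  have hD₀ : 0 ≤ D := dist_nonneg.trans (hD K (hs hKs) q hq q hq)
  refine hchain.trans (mul_le_mul_of_nonneg_right ?_ hD₀)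
  rw [Fintype.card_coe]
  exact (Nat.cast_le.2 (Finset.card_le_card hs)).trans
    (hT.card_neighbors_le hδ hδC (subCells_subset hK))

theorem mem_frontier_of_mem_cell (hK : K ∈ T.cells) {p : Eucl d} (hp : p ∈ K)
    (hpΩ : p ∉ interior (closure Ω)) : p ∈ frontier Ω :=
  ⟨convexHull_subset_closure hK (subset_convexHull ℝ _ hp),
    fun h => hpΩ (interior_mono subset_closure h)⟩

open Classical in
theorem IsRegularMesh.card_filter_mem_le [NeZero d] (hT : T.IsRegularMesh θ h) (p : Eucl d) :
    (({K ∈ T.cells | p ∈ K} : Finset (Finset (Eucl d))).card : ℝ) ≤ (1 / θ) ^ d := by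
  refine hT.card_le (x := p) (Finset.filter_subset _ _) zero_le_one fun K hK w hw => ?_
  obtain ⟨hKc, hpK⟩ := Finset.mem_filter.1 hK
  rw [one_mul, mem_closedBall]
  exact hT.dist_le hKc hw (subset_convexHull ℝ _ hpK)

theorem IsRegularMesh.exists_le_volume_inter [NeZero d] (hT : T.IsRegularMesh θ h) (hη : 0 < η)
    {p z : Eucl d} (hz : ball z (η * h) ⊆ Ωk ∩ T.star p) :
    ∃ L ∈ T.cells, p ∈ L ∧
      (θ * η * h) ^ d * unitBallVolume d ≤ volume.real (interior Δ[L] ∩ Ωk) := by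
  classical
  have hθ := hT.regularity_pos
  have hηh : 0 < η * h := mul_pos hη hT.size_pos
  let s := {L ∈ T.cells | p ∈ L}
  have hcover : ball z (η * h) ⊆ ⋃ L ∈ s, Δ[L] ∩ Ωk := fun w hw => by
    obtain ⟨L, hL, hpL, hwL⟩ := mem_star_iff.1 (hz hw).2
    exact Set.mem_iUnion₂.2 ⟨L, Finset.mem_filter.2 ⟨hL, hpL⟩, hwL, (hz hw).1⟩
  have hfin : volume (⋃ L ∈ s, Δ[L] ∩ Ωk) ≠ ⊤ :=
    ((Bornology.isBounded_biUnion_finset _).2 fun L _ =>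
      (isBounded_convexHull.2 L.finite_toSet.isBounded).subset
        Set.inter_subset_left).measure_lt_top.ne
  have hsum : (η * h) ^ d * unitBallVolume d ≤ ∑ L ∈ s, volume.real (interior Δ[L] ∩ Ωk) := by
    rw [← volume_real_ball z hηh.le]
    refine ((measureReal_mono hcover hfin).trans (measureReal_biUnion_finset_le s _)).trans_eq ?_
    exact Finset.sum_congr rfl fun L _ => measureReal_congr
      ((interior_convexHull_ae_eq L).symm.inter (Filter.EventuallyEq.refl _ _))
  have hsne : s.Nonempty := by
    obtain ⟨L, hL, hpL, -⟩ := mem_star_iff.1 (hz (mem_ball_self hηh)).2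
    exact ⟨L, Finset.mem_filter.2 ⟨hL, hpL⟩⟩
  obtain ⟨L, hL, hle⟩ : ∃ L ∈ s,
      (θ * η * h) ^ d * unitBallVolume d ≤ volume.real (interior Δ[L] ∩ Ωk) := by
    refine Finset.exists_le_of_sum_le hsne (le_trans ?_ hsum)
    have hω := unitBallVolume_pos d
    calc ∑ _L ∈ s, (θ * η * h) ^ d * unitBallVolume d
        = s.card * ((θ * η * h) ^ d * unitBallVolume d) := by rw [Finset.sum_const, nsmul_eq_mul]
      _ ≤ (1 / θ) ^ d * ((θ * η * h) ^ d * unitBallVolume d) := by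
          have hh := hT.size_pos
          gcongr
          exact hT.card_filter_mem_le p
      _ = (η * h) ^ d * unitBallVolume d := by
          rw [← mul_assoc, ← mul_pow, mul_assoc, one_div, inv_mul_cancel_left₀ hθ.ne']
  obtain ⟨hLc, hpL⟩ := Finset.mem_filter.1 hL
  exact ⟨L, hLc, hpL, hle⟩

theorem IsRegularMesh.exists_vertex_mem_frontier_or_le_volume [NeZero d]
    (hT : T.IsRegularMesh θ h) (hΩ : interior (closure Ω) ⊆ Ω) (hδ : 0 ≤ δ) (hη : 0 < η) {r : ℝ}
    (hr : r ≤ θ / (d + 1) * h) (hballs : HasInteriorBalls Ω Ωk r (η * h))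
    (hL : L ∈ T.cells) {z : Eucl d} (hzL : z ∈ Δ[L])
    (hz : z ∈ closure Ωk ∨ z ∉ interior (closure Ω)) :
    ∃ p ∈ L, p ∈ frontier Ω ∨ ∃ L' ∈ T.subCells Ωk δ, p ∈ L' ∧
      (θ * η * h) ^ d * unitBallVolume d ≤ volume.real (interior Δ[L'] ∩ Ωk) := by
  rcases hz with hz | hz
  · obtain ⟨p, hp, hpz⟩ := (isFullSimplex hL).exists_inv_card_le_bary z
    refine ⟨p, hp, ?_⟩
    by_cases hpΩ : p ∈ interior (closure Ω)
    · right
      have hstar : ball z r ⊆ T.star p := by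
        refine hT.ball_subset_star hpΩ (convexHull_subset_closure hL hzL) ?_
        rw [hat_eq_bary hL hzL]
        refine hr.trans (le_trans (le_of_eq ?_) (mul_le_mul_of_nonneg_left hpz hT.radius_pos.le))
        rw [card_of_mem_cells hL]
        push_cast
        ring
      have hzΩ : ball z r ⊆ Ω :=
        (interior_maximal (hstar.trans (star_subset_closure p)) isOpen_ball).trans hΩ
      obtain ⟨y, hy⟩ := hballs z hz hzΩ
      obtain ⟨L', hL', hpL', hvol⟩ := hT.exists_le_volume_inter hη
        (hy.trans (Set.inter_subset_inter_right _ hstar))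
      have hpos : 0 < volume.real (interior Δ[L'] ∩ Ωk) := by
        have := unitBallVolume_pos d
        have := hT.regularity_pos
        have := hT.size_pos
        exact hvol.trans_lt' (by positivity)
      refine ⟨L', mem_subCells_of_inter_nonempty hL' hδ ?_, hpL', hvol⟩
      exact (nonempty_of_measure_ne_zero ((measureReal_ne_zero_iff (measure_ne_top_of_subset
        Set.inter_subset_left (volume_interior_convexHull_lt_top L').ne)).1 hpos.ne')).mono
        (Set.inter_subset_inter_left _ interior_subset)
    · exact Or.inl (mem_frontier_of_mem_cell hL hp hpΩ)
  · obtain ⟨p, hp, hpΩ⟩ := exists_vertex_notMem_interior hL hzL hz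
    exact ⟨p, hp, Or.inl (mem_frontier_of_mem_cell hL hp hpΩ)⟩

end Triangulation

/-! ### The coercivity estimate -/

namespace Triangulation

variable {d : ℕ} {Ω Ωk : Set (Eucl d)} {T : Triangulation Ω} {δ θ h C η : ℝ}
  {K L : Finset (Eucl d)} {G : Eucl d → Eucl d}

variable (T Ωk δ) in
/-- The contribution of one cell to the right-hand side of the coercivity estimate. -/
def cellData (G : Eucl d → Eucl d) (L : Finset (Eucl d)) : ℝ :=
  (∫ x in interior Δ[L], T.energy Ωk δ G x) + ∫ x in interior Δ[L] ∩ Ωk, ‖G x‖ ^ 2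

variable (T Ωk δ) in
/-- The contribution of the neighbours of `K` to the right-hand side of the coercivity estimate. -/
def neighborData (h : ℝ) (G : Eucl d → Eucl d) (K : Finset (Eucl d)) : ℝ :=
  ∑ L ∈ T.neighbors Ωk δ h K, T.cellData Ωk δ G L

theorem setIntegral_energy_le_cellData (G : Eucl d → Eucl d) (L : Finset (Eucl d)) :
    ∫ x in interior Δ[L], T.energy Ωk δ G x ≤ T.cellData Ωk δ G L :=
  le_add_of_nonneg_right (integral_nonneg fun _ => sq_nonneg _)

theorem cellData_nonneg (G : Eucl d → Eucl d) (hL : L ∈ T.subCells Ωk δ) :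
    0 ≤ T.cellData Ωk δ G L :=
  (setIntegral_energy_nonneg G hL).trans (setIntegral_energy_le_cellData G L)

theorem cellData_le_neighborData (G : Eucl d → Eucl d) (hL : L ∈ T.neighbors Ωk δ h K) :
    T.cellData Ωk δ G L ≤ T.neighborData Ωk δ h G K :=
  Finset.single_le_sum (fun _ hL' => cellData_nonneg G (neighbors_subset hL')) hL

theorem neighborData_nonneg (G : Eucl d → Eucl d) (K : Finset (Eucl d)) :
    0 ≤ T.neighborData Ωk δ h G K :=
  Finset.sum_nonneg fun _ hL => cellData_nonneg G (neighbors_subset hL)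

/-- The constant with which `neighborData` bounds, scaled by `h ^ d * unitBallVolume d`, the squared
differences of the nodal values within a cell and some nodal value of a cell of which a part of
volume `(θ η h) ^ d * unitBallVolume d` lies in `Ωk`. -/
def nodalConst (d : ℕ) (θ η : ℝ) : ℝ :=
  8 / θ * (2 / θ) ^ d + 2 / (θ * η) ^ d

variable (T Ωk δ) in
/-- The bound for the nodal values, and for their differences, in the neighbours of `K`. -/
def nodalBound (θ h η : ℝ) (G : Eucl d → Eucl d) (K : Finset (Eucl d)) : ℝ :=
  √(nodalConst d θ η * T.neighborData Ωk δ h G K / (h ^ d * unitBallVolume d))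

theorem le_nodalBound (hh : 0 < h) {s : ℝ}
    (hs : h ^ d * unitBallVolume d * s ^ 2 ≤ nodalConst d θ η * T.neighborData Ωk δ h G K) :
    s ≤ T.nodalBound Ωk δ θ h η G K := by
  have hω := unitBallVolume_pos d
  refine Real.le_sqrt_of_sq_le ?_
  rwa [le_div_iff₀' (by positivity)]

theorem dist_nodeVal_le [NeZero d] (hT : T.IsRegularMesh θ h) (hη : 0 < η)
    (hG : MemLp G 2 (volume.restrict (T.extDomain Ωk δ))) (hL : L ∈ T.neighbors Ωk δ h K)
    {p q : Eucl d} (hp : p ∈ L) (hq : q ∈ L) :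
    dist (T.nodeVal Ωk δ G p) (T.nodeVal Ωk δ G q) ≤ T.nodalBound Ωk δ θ h η G K := by
  have hθ := hT.regularity_pos
  have hdata := neighborData_nonneg (T := T) (Ωk := Ωk) (δ := δ) (h := h) G K
  rw [dist_eq_norm]
  refine le_nodalBound hT.size_pos ?_
  calc h ^ d * unitBallVolume d * ‖T.nodeVal Ωk δ G p - T.nodeVal Ωk δ G q‖ ^ 2
      ≤ 8 / θ * (2 / θ) ^ d * ∫ x in interior Δ[L], T.energy Ωk δ G x :=
        norm_nodeVal_sub_sq_le hT hG (neighbors_subset hL) hp hq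
    _ ≤ 8 / θ * (2 / θ) ^ d * T.neighborData Ωk δ h G K := by
        gcongr
        exact (setIntegral_energy_le_cellData G L).trans (cellData_le_neighborData G hL)
    _ ≤ nodalConst d θ η * T.neighborData Ωk δ h G K :=
        mul_le_mul_of_nonneg_right (le_add_of_nonneg_right (by positivity)) hdata

theorem exists_norm_nodeVal_le (hT : T.IsRegularMesh θ h) (hη : 0 < η)
    (hG : MemLp G 2 (volume.restrict (T.extDomain Ωk δ))) (hΩk : IsOpen Ωk)
    (hL : L ∈ T.neighbors Ωk δ h K)
    (hvol : (θ * η * h) ^ d * unitBallVolume d ≤ volume.real (interior Δ[L] ∩ Ωk)) :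
    ∃ q ∈ L, ‖T.nodeVal Ωk δ G q‖ ≤ T.nodalBound Ωk δ θ h η G K := by
  have hθ := hT.regularity_pos
  have hdata := neighborData_nonneg (T := T) (Ωk := Ωk) (δ := δ) (h := h) G K
  obtain ⟨q, hq, hle⟩ := exists_norm_nodeVal_sq_le hG hΩk (neighbors_subset hL)
  refine ⟨q, hq, le_nodalBound hT.size_pos ?_⟩
  calc h ^ d * unitBallVolume d * ‖T.nodeVal Ωk δ G q‖ ^ 2
      = ((θ * η * h) ^ d * unitBallVolume d * ‖T.nodeVal Ωk δ G q‖ ^ 2) / (θ * η) ^ d := by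
        rw [mul_pow _ h]
        field_simp
    _ ≤ 2 * T.neighborData Ωk δ h G K / (θ * η) ^ d := by
        refine div_le_div_of_nonneg_right ?_ (by positivity)
        exact ((mul_le_mul_of_nonneg_right hvol (sq_nonneg _)).trans hle).trans
          (mul_le_mul_of_nonneg_left (cellData_le_neighborData G hL) zero_le_two)
    _ = 2 / (θ * η) ^ d * T.neighborData Ωk δ h G K := by ring
    _ ≤ nodalConst d θ η * T.neighborData Ωk δ h G K :=
        mul_le_mul_of_nonneg_right (le_add_of_nonneg_left (by positivity)) hdata

theorem sum_cellData_le (hG : MemLp G 2 (volume.restrict (T.extDomain Ωk δ)))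
    (hΩk : IsOpen Ωk) (hsub : Ωk ⊆ T.extDomain Ωk δ) :
    ∑ L ∈ T.subCells Ωk δ, T.cellData Ωk δ G L ≤
      (∫ x in Ωk, ‖G x‖ ^ 2) + T.stab Ωk δ G G := by
  have hint : IntegrableOn (fun x => ‖G x‖ ^ 2) Ωk := (integrableOn_norm_sq hG).mono_set hsub
  simp only [cellData]
  rw [Finset.sum_add_distrib, stab_eq_integral_energy hG,
    setIntegral_extDomain (integrableOn_energy hG), add_comm]
  gcongr
  rw [← integral_biUnion_finset _
    (fun _ _ => isOpen_interior.measurableSet.inter hΩk.measurableSet)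
    (fun K hK L hL hKL => (pairwiseDisjoint_interior subCells_subset hK hL hKL).mono
      Set.inter_subset_left Set.inter_subset_left)
    (fun _ _ => hint.mono_set Set.inter_subset_right)]
  exact setIntegral_mono_set hint (Filter.Eventually.of_forall fun _ => sq_nonneg _)
    (Set.iUnion₂_subset fun _ _ => Set.inter_subset_right).eventuallyLE

/-- The constant of the coercivity estimate on a mesh of regularity `θ` with `δ ≤ C h`, if `Ωk`
contains balls of radius `η h` near each of its points away from `∂Ω`. -/
def coercivityConst (d : ℕ) (θ C η : ℝ) : ℝ :=
  overlapBound d θ C * (2 + 2 * ((overlapBound d θ C + 2) ^ 2 * nodalConst d θ η))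

theorem coercivityConst_pos (hθ : 0 < θ) (hC : 0 ≤ C) (hη : 0 < η) :
    0 < coercivityConst d θ C η := by
  rw [coercivityConst, overlapBound, nodalConst]
  positivity

/-- The coercivity estimate for arbitrary square integrable vector fields in place of gradients. -/
def IsFieldCoercive (T : Triangulation Ω) (Ωk : Set (Eucl d)) (δ c : ℝ) : Prop :=
  ∀ G : Eucl d → Eucl d, MemLp G 2 (volume.restrict (T.extDomain Ωk δ)) →
    ∫ x in T.extDomain Ωk δ, ‖G x‖ ^ 2 ≤ c * ((∫ x in Ωk, ‖G x‖ ^ 2) + T.stab Ωk δ G G)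

theorem IsFieldCoercive.isCoercive {c : ℝ} (hT : T.IsFieldCoercive Ωk δ c) :
    T.IsCoercive Ωk δ c := fun _ G hu => hT G hu.memLp_grad

variable [NeZero d]

/-- The nodal values are small at a vertex of the last cell of a chain, and differ little along the
chain. -/
theorem norm_nodeVal_le (hT : T.IsRegularMesh θ h) (hΩ : interior (closure Ω) ⊆ Ω)
    (hΩk : IsOpen Ωk) (hne : Ωk.Nonempty) (hδ : 0 ≤ δ) (hδC : δ ≤ C * h) (hη : 0 < η) {r : ℝ}
    (hr : r ≤ θ / (d + 1) * h) (hballs : HasInteriorBalls Ω Ωk r (η * h))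
    (hG : MemLp G 2 (volume.restrict (T.extDomain Ωk δ))) (hK : K ∈ T.subCells Ωk δ) {q : Eucl d}
    (hq : q ∈ K) :
    ‖T.nodeVal Ωk δ G q‖ ≤ (overlapBound d θ C + 2) * T.nodalBound Ωk δ θ h η G K := by
  set D := T.nodalBound Ωk δ θ h η G K
  have hosc : ∀ L ∈ T.neighbors Ωk δ h K, ∀ p ∈ L, ∀ q ∈ L,
      dist (T.nodeVal Ωk δ G p) (T.nodeVal Ωk δ G q) ≤ D := fun L hL p hp q hq =>
    dist_nodeVal_le hT hη hG hL hp hq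
  obtain ⟨x, hx, z, hxz, hseg, hend⟩ := exists_segment_subset_closure hne hK
  obtain ⟨L, hL, hzL⟩ := (mem_closure_iff (T := T)).1 (hxz (right_mem_segment ℝ x z))
  obtain ⟨p, hp, hpend⟩ :=
    hT.exists_vertex_mem_frontier_or_le_volume hΩ hδ hη hr hballs hL hzL hend
  have hgp : ‖T.nodeVal Ωk δ G p‖ ≤ 2 * D := by
    rcases hpend with hpΩ | ⟨L', hL', hpL', hvol⟩
    · rw [nodeVal_of_mem_frontier G hpΩ, norm_zero]
      exact mul_nonneg zero_le_two (Real.sqrt_nonneg _)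
    · have hpx : dist x p ≤ δ + h := (dist_triangle x z p).trans (add_le_add
        (hseg z (right_mem_segment ℝ x z)).2 (hT.dist_le hL hzL (subset_convexHull ℝ _ hp)))
      have hL'K : L' ∈ T.neighbors Ωk δ h K :=
        mem_neighbors.2 ⟨hL', x, hx, p, subset_convexHull ℝ _ hpL', hpx⟩
      obtain ⟨v, hv, hgv⟩ := exists_norm_nodeVal_le hT hη hG hΩk hL'K hvol
      linarith [norm_le_norm_add_norm_sub' (T.nodeVal Ωk δ G p) (T.nodeVal Ωk δ G v),
        dist_eq_norm (T.nodeVal Ωk δ G p) (T.nodeVal Ωk δ G v), hosc L' hL'K p hpL' v hv]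
  have hchain := dist_le_overlapBound_mul hT hδ hδC hK hosc hx hxz hseg hL hzL hq hp
  rw [dist_eq_norm] at hchain
  linarith [norm_le_norm_add_norm_sub' (T.nodeVal Ωk δ G q) (T.nodeVal Ωk δ G p)]

theorem setIntegral_norm_sq_le_neighborData (hT : T.IsRegularMesh θ h)
    (hΩ : interior (closure Ω) ⊆ Ω) (hΩk : IsOpen Ωk) (hne : Ωk.Nonempty) (hδ : 0 ≤ δ)
    (hδC : δ ≤ C * h) (hη : 0 < η) {r : ℝ} (hr : r ≤ θ / (d + 1) * h)
    (hballs : HasInteriorBalls Ω Ωk r (η * h))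
    (hG : MemLp G 2 (volume.restrict (T.extDomain Ωk δ))) (hK : K ∈ T.subCells Ωk δ) :
    ∫ x in interior Δ[K], ‖G x‖ ^ 2 ≤
      (2 + 2 * ((overlapBound d θ C + 2) ^ 2 * nodalConst d θ η)) * T.neighborData Ωk δ h G K := by
  have hθ := hT.regularity_pos
  have hh := hT.size_pos
  have hω := unitBallVolume_pos d
  have hdata := neighborData_nonneg (T := T) (Ωk := Ωk) (δ := δ) (h := h) G K
  have hbound : h ^ d * unitBallVolume d * T.nodalBound Ωk δ θ h η G K ^ 2 =
      nodalConst d θ η * T.neighborData Ωk δ h G K := by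
    have hconst : 0 ≤ nodalConst d θ η := by rw [nodalConst]; positivity
    rw [nodalBound, Real.sq_sqrt (by positivity), mul_div_cancel₀ _ (by positivity)]
  have henergy : ∫ x in interior Δ[K], T.energy Ωk δ G x ≤ T.neighborData Ωk δ h G K :=
    (setIntegral_energy_le_cellData G K).trans
      (cellData_le_neighborData G (mem_neighbors_self hδ hh.le hK))
  calc ∫ x in interior Δ[K], ‖G x‖ ^ 2
      ≤ 2 * (∫ x in interior Δ[K], T.energy Ωk δ G x) + 2 * (h ^ d * unitBallVolume d *
          ((overlapBound d θ C + 2) * T.nodalBound Ωk δ θ h η G K) ^ 2) :=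
        setIntegral_norm_sq_le hT hG hK fun q hq => pow_le_pow_left₀ (norm_nonneg _)
          (norm_nodeVal_le hT hΩ hΩk hne hδ hδC hη hr hballs hG hK hq) 2
    _ = 2 * (∫ x in interior Δ[K], T.energy Ωk δ G x) + 2 * ((overlapBound d θ C + 2) ^ 2 *
          (nodalConst d θ η * T.neighborData Ωk δ h G K)) := by
        rw [← hbound]; ring
    _ ≤ 2 * T.neighborData Ωk δ h G K + 2 * ((overlapBound d θ C + 2) ^ 2 *
          (nodalConst d θ η * T.neighborData Ωk δ h G K)) := by gcongr
    _ = _ := by ring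

theorem sum_neighborData_le (hT : T.IsRegularMesh θ h) (hδ : 0 ≤ δ) (hδC : δ ≤ C * h)
    (G : Eucl d → Eucl d) :
    ∑ K ∈ T.subCells Ωk δ, T.neighborData Ωk δ h G K ≤
      overlapBound d θ C * ∑ L ∈ T.subCells Ωk δ, T.cellData Ωk δ G L := by
  simp only [neighborData]
  rw [Finset.sum_comm' (t' := T.subCells Ωk δ) (s' := T.neighbors Ωk δ h) fun K L =>
    ⟨fun ⟨hK, hL⟩ => ⟨mem_neighbors_symm hK hL, neighbors_subset hL⟩,
      fun ⟨hK, hL⟩ => ⟨neighbors_subset hK, mem_neighbors_symm hL hK⟩⟩, Finset.mul_sum]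
  refine Finset.sum_le_sum fun L hL => ?_
  rw [Finset.sum_const, nsmul_eq_mul]
  exact mul_le_mul_of_nonneg_right (hT.card_neighbors_le hδ hδC (subCells_subset hL))
    (cellData_nonneg G hL)

theorem IsRegularMesh.isFieldCoercive (hT : T.IsRegularMesh θ h)
    (hΩ : interior (closure Ω) ⊆ Ω) (hΩk : IsOpen Ωk) (hne : Ωk.Nonempty) (hsub : Ωk ⊆ Ω)
    (hδ : 0 ≤ δ) (hδC : δ ≤ C * h) (hη : 0 < η) {r : ℝ} (hr : r ≤ θ / (d + 1) * h)
    (hballs : HasInteriorBalls Ω Ωk r (η * h)) :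
    T.IsFieldCoercive Ωk δ (coercivityConst d θ C η) := by
  intro G hG
  have hθ := hT.regularity_pos
  have hC : 0 ≤ C := nonneg_of_mul_nonneg_left (hδ.trans hδC) hT.size_pos
  have hN : 0 ≤ overlapBound d θ C := by rw [overlapBound]; positivity
  set A := 2 + 2 * ((overlapBound d θ C + 2) ^ 2 * nodalConst d θ η)
  have hA : 0 ≤ A := by simp only [A, nodalConst]; positivity
  calc ∫ x in T.extDomain Ωk δ, ‖G x‖ ^ 2
      = ∑ K ∈ T.subCells Ωk δ, ∫ x in interior Δ[K], ‖G x‖ ^ 2 :=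
        setIntegral_extDomain (integrableOn_norm_sq hG)
    _ ≤ ∑ K ∈ T.subCells Ωk δ, A * T.neighborData Ωk δ h G K := Finset.sum_le_sum fun K hK =>
        setIntegral_norm_sq_le_neighborData hT hΩ hΩk hne hδ hδC hη hr hballs hG hK
    _ ≤ A * (overlapBound d θ C * ∑ L ∈ T.subCells Ωk δ, T.cellData Ωk δ G L) := by
        rw [← Finset.mul_sum]
        exact mul_le_mul_of_nonneg_left (sum_neighborData_le hT hδ hδC G) hA
    _ ≤ A * (overlapBound d θ C * ((∫ x in Ωk, ‖G x‖ ^ 2) + T.stab Ωk δ G G)) := by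
        gcongr
        exact sum_cellData_le hG hΩk (subset_extDomain hΩk hsub hδ)
    _ = coercivityConst d θ C η * ((∫ x in Ωk, ‖G x‖ ^ 2) + T.stab Ωk δ G G) := by
        rw [coercivityConst]; ring

end Triangulation

/-- The coercivity constant of a shape regular and quasiuniform mesh, for an interior ball condition
of ratio `κ` that is applied at the scale `μ h`. -/
def meshConst (d : ℕ) (σ τ C κ μ : ℝ) : ℝ :=
  Triangulation.coercivityConst d (max σ 1 * max τ 1)⁻¹ (max C 0) (κ * μ)

theorem meshConst_pos (d : ℕ) {κ μ : ℝ} (σ τ C : ℝ) (hκ : 0 < κ) (hμ : 0 < μ) :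
    0 < meshConst d σ τ C κ μ :=
  Triangulation.coercivityConst_pos (by positivity) (le_max_right _ _) (by positivity)

theorem IsInteriorBallSubdomain.isFieldCoercive {d : ℕ} [NeZero d] {Ω D : Set (Eucl d)}
    {T : Triangulation Ω} {σ τ C κ r₀ μ h δ : ℝ} (hD : IsInteriorBallSubdomain Ω D κ r₀)
    (hΩ : interior (closure Ω) ⊆ Ω) (hκ : 0 < κ) (hσ : T.IsShapeRegular σ)
    (hτ : T.IsQuasiUniform τ h) (hδ : 0 ≤ δ) (hδC : δ ≤ C * h) (hμ : 0 < μ)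
    (hμθ : μ ≤ (max σ 1 * max τ 1)⁻¹ / (d + 1)) (hμr : μ * h ≤ r₀) :
    T.IsFieldCoercive D δ (meshConst d σ τ C κ μ) := by
  have hT := hσ.isRegularMesh (hD.nonempty.mono hD.subset) hτ
  have hh := hT.size_pos
  have hballs := hD.hasInteriorBalls (μ * h) (by positivity) hμr
  rw [← mul_assoc] at hballs
  exact hT.isFieldCoercive hΩ hD.isOpen hD.nonempty hD.subset hδ
    (hδC.trans (mul_le_mul_of_nonneg_right (le_max_left C 0) hh.le)) (by positivity)
    (mul_le_mul_of_nonneg_right hμθ hh.le) hballs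

end PG

end

theorem mainTheorem6_general (d : ℕ) [NeZero d] (σ τ C κ : ℝ) (hκ : 0 < κ) :
    ∃ c : ℝ, 0 < c ∧
      ∀ (Ω : Set (PG.Eucl d)) (r₀ : ℝ), interior (closure Ω) ⊆ Ω → 0 < r₀ →
        (∃ h₀ : ℝ, 0 < h₀ ∧
          ∀ (T : PG.Triangulation Ω) (h δ : ℝ) (D : Set (PG.Eucl d)), T.IsShapeRegular σ →
            T.IsQuasiUniform τ h → h ≤ h₀ → 0 ≤ δ → δ ≤ C * h →
            PG.IsInteriorBallSubdomain Ω D κ r₀ → T.IsFieldCoercive D δ c) ∧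
        (∃ c' : ℝ, 0 < c' ∧
          ∀ (T : PG.Triangulation Ω) (h δ : ℝ) (D : Set (PG.Eucl d)), T.IsShapeRegular σ →
            T.IsQuasiUniform τ h → 0 ≤ δ → δ ≤ C * h →
            PG.IsInteriorBallSubdomain Ω D κ r₀ → T.IsFieldCoercive D δ c') := by
  set ν := (max σ 1 * max τ 1)⁻¹ / (d + 1)
  have hν : 0 < ν := by positivity
  refine ⟨PG.meshConst d σ τ C κ ν, PG.meshConst_pos d σ τ C hκ hν, fun Ω r₀ hΩ hr₀ => ⟨?_, ?_⟩⟩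
  · refine ⟨r₀ / ν, by positivity, fun T h δ D hσ hτ hh hδ hδC hD =>
      hD.isFieldCoercive hΩ hκ hσ hτ hδ hδC hν le_rfl ?_⟩
    rwa [le_div_iff₀' hν] at hh
  · set H := max τ 1 * (Metric.diam Ω + 1)
    have hH : 0 < H := mul_pos (by positivity) (by linarith [Metric.diam_nonneg (s := Ω)])
    have hμ : 0 < min ν (r₀ / H) := by positivity
    refine ⟨PG.meshConst d σ τ C κ (min ν (r₀ / H)), PG.meshConst_pos d σ τ C hκ hμ,
      fun T h δ D hσ hτ hδ hδC hD =>
        hD.isFieldCoercive hΩ hκ hσ hτ hδ hδC hμ (min_le_left _ _) ?_⟩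
    have hhH : h ≤ H := (hτ.le_max_mul_diam_domain (hD.nonempty.mono hD.subset)).trans
      (mul_le_mul_of_nonneg_left (le_add_of_nonneg_right zero_le_one) (by positivity))
    calc min ν (r₀ / H) * h ≤ min ν (r₀ / H) * H := mul_le_mul_of_nonneg_left hhH hμ.le
      _ ≤ r₀ := (le_div_iff₀ hH).1 (min_le_right _ _)

theorem mainTheorem6 (d : ℕ) (hd : d = 2 ∨ d = 3) (σ τ C : ℝ) :
    ∃ c : ℝ, 0 < c ∧
      ∀ Ω Ω₁ Ω₂ Γ : Set (PG.Eucl d),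
        PG.IsBoundedLipschitzDomain Ω → PG.IsSmoothInterface Ω Ω₁ Ω₂ Γ →
        (∃ h₀ : ℝ, 0 < h₀ ∧
          ∀ (T : PG.Triangulation Ω) (h δ : ℝ), T.IsShapeRegular σ → T.IsQuasiUniform τ h →
            h ≤ h₀ → 0 ≤ δ → δ ≤ C * h →
            T.IsCoercive Ω₁ δ c ∧ T.IsCoercive Ω₂ δ c) ∧
        (∃ c' : ℝ, 0 < c' ∧
          ∀ (T : PG.Triangulation Ω) (h δ : ℝ), T.IsShapeRegular σ → T.IsQuasiUniform τ h →
            0 ≤ δ → δ ≤ C * h →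
            T.IsCoercive Ω₁ δ c' ∧ T.IsCoercive Ω₂ δ c') := by
  have : NeZero d := ⟨by omega⟩
  obtain ⟨c, hc, hgeneral⟩ := mainTheorem6_general d σ τ C (1 / 4) (by norm_num)
  refine ⟨c, hc, fun Ω Ω₁ Ω₂ Γ hΩ hI => ?_⟩
  obtain ⟨r₁, hr₁, hΩ₁⟩ := hI.exists_isInteriorBallSubdomain hΩ.isBounded
  obtain ⟨r₂, hr₂, hΩ₂⟩ := hI.symm.exists_isInteriorBallSubdomain hΩ.isBounded
  replace hΩ₁ := hΩ₁.mono (min_le_left r₁ r₂)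
  replace hΩ₂ := hΩ₂.mono (min_le_right r₁ r₂)
  obtain ⟨⟨h₀, hh₀, hfine⟩, c', hc', hall⟩ :=
    hgeneral Ω (min r₁ r₂) hΩ.interior_closure_subset (lt_min hr₁ hr₂)
  exact
    ⟨⟨h₀, hh₀, fun T h δ hσ hτ hh hδ hδC =>
        ⟨(hfine T h δ Ω₁ hσ hτ hh hδ hδC hΩ₁).isCoercive,
          (hfine T h δ Ω₂ hσ hτ hh hδ hδC hΩ₂).isCoercive⟩⟩,
      c', hc', fun T h δ hσ hτ hδ hδC =>
        ⟨(hall T h δ Ω₁ hσ hτ hδ hδC hΩ₁).isCoercive,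
          (hall T h δ Ω₂ hσ hτ hδ hδC hΩ₂).isCoercive⟩⟩
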